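/- Let $\alpha$ be an irrational number with bounded partial quotients and let $Tx=x+\alpha$ be the corresponding rotation of the circle $\mathbb{T}=\mathbb{R}/\mathbb{Z}$ (identified with $[0,1)$), with Lebesgue measure $\lambda$. Let $f:\mathbb{T}\to(0,\infty)$ be piecewise constant (i.e. locally constant off a finite set), let $\{\xi_1,\dots,\xi_p\}\subset[0,1)$ be the set of its discontinuity points, assumed non-empty, and let $$d_i=\lim_{x\to\xi_i^-}f(x)-\lim_{x\to\xi_i^+}f(x)$$ be the jump at $\xi_i$; the sum of jumps $\sum_{i=1}^p d_i$ is $0$. Suppose that (P1) whenever $\sum_{i=1}^p n_id_i=0$ with $n_1,\dots,n_p\in\mathbb{Z}$ not all zero, there exist $1\le i<i'\le p$ such that $n_i\neq0$, $n_{i'}\ne 0$ and $\xi_i-\xi_{i'}\in(\mathbb{Q}+\mathbb{Q}\alpha)\setminus(\mathbb{Z}+\mathbb{Z}\alpha)$; (P2) $\int_{\mathbb{T}} f\,d\lambda\notin\sum_{i=1}^p(\xi_i+\mathbb{Q}+\mathbb{Q}\alpha)\,d_i$. Let $T^f=(T^f_t)_{t\in\mathbb{R}}$ be the special flow over $T$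 under $f$: on $X^f=\{(x,s)\in\mathbb{T}\times\mathbb{R}: 0\le s<f(x)\}$ with the restriction of the product Lebesgue measure, $T^f_t(x,s)=(T^nx,\,s+t-f^{(n)}(x))$, where $f^{(m)}(x)=\sum_{0\le j<m}f(T^jx)$ for $m\ge0$, $f^{(m)}(x)=-\sum_{m\le j<0}f(T^jx)$ for $m<0$, and $n\in\mathbb{Z}$ is the unique integer with $f^{(n)}(x)\le s+t<f^{(n+1)}(x)$. Then $T^f$ is weakly mixing: if $r\in\mathbb{R}$ and $g:X^f\to\mathbb{C}$ is measurable with $g\circ T^f_t=e^{2\pi i r t}g$ almost everywhere for every $t\in\mathbb{R}$, then $g$ is almost everywhere constant. -/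

import Mathlib

open MeasureTheory Filter Topology

namespace SpecialFlow

noncomputable section

/-- The circle `𝕋 = ℝ/ℤ`, with its Lebesgue probability measure `volume`. -/
abbrev Circ : Type := UnitAddCircle

/-- The representative in `[0,1)` of a point of the circle. -/
def rep (x : Circ) : ℝ := (AddCircle.equivIco (1 : ℝ) 0 x : ℝ)

/-- The partial quotients `a₁, a₂, …` of the continued fraction expansion of `α` are bounded. -/
def HasBoundedPartialQuotients (α : ℝ) : Prop :=
  ∃ C : ℝ, ∀ (n : ℕ) (a : ℝ), (GenContFract.of α).partDens.get? n = some a → a ≤ C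

/-- `f` is piecewise constant: it is locally constant off a finite subset of the circle, i.e.
constant on each of the finitely many open arcs into which that set cuts the circle. -/
def IsPiecewiseConstant (f : Circ → ℝ) : Prop :=
  ∃ S : Set Circ, S.Finite ∧ ∀ x ∉ S, ∀ᶠ y in 𝓝 x, f y = f x

/-- The limit of `f` at `ξ` from the left. -/
def leftLimit (f : Circ → ℝ) (ξ : Circ) : ℝ :=
  limUnder (𝓝[<] (0 : ℝ)) (fun t : ℝ => f (ξ + (t : Circ)))

/-- The limit of `f` at `ξ` from the right. -/
def rightLimit (f : Circ → ℝ) (ξ : Circ) : ℝ :=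
  limUnder (𝓝[>] (0 : ℝ)) (fun t : ℝ => f (ξ + (t : Circ)))

/-- The jump `d(ξ) = lim_{x → ξ⁻} f(x) - lim_{x → ξ⁺} f(x)`. -/
def jump (f : Circ → ℝ) (ξ : Circ) : ℝ := leftLimit f ξ - rightLimit f ξ

/-- `ℚ + ℚα`, as a subset of the circle (it contains `ℤ`). -/
def ratSpan (α : ℝ) : Set Circ := {x | ∃ q r : ℚ, x = ((q + r * α : ℝ) : Circ)}

/-- `ℤ + ℤα`, as a subset of the circle (it contains `ℤ`). -/
def intSpan (α : ℝ) : Set Circ := {x | ∃ k l : ℤ, x = ((k + l * α : ℝ) : Circ)}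

/-- Property (P1) of a roof function `f` whose set of discontinuities is `Ξ`. -/
def PropertyP1 (α : ℝ) (f : Circ → ℝ) (Ξ : Finset Circ) : Prop :=
  ∀ n : Circ → ℤ, (∃ ξ ∈ Ξ, n ξ ≠ 0) → ∑ ξ ∈ Ξ, (n ξ : ℝ) * jump f ξ = 0 →
    ∃ ξ ∈ Ξ, ∃ ξ' ∈ Ξ, ξ ≠ ξ' ∧ n ξ ≠ 0 ∧ n ξ' ≠ 0 ∧ ξ - ξ' ∈ ratSpan α \ intSpan α

/-- Property (P2) of a roof function `f` whose set of discontinuities is `Ξ`. -/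
def PropertyP2 (α : ℝ) (f : Circ → ℝ) (Ξ : Finset Circ) : Prop :=
  ¬ ∃ q r : Circ → ℚ, ∫ x, f x = ∑ ξ ∈ Ξ, (rep ξ + q ξ + r ξ * α) * jump f ξ

/-- The cocycle `f^{(m)}(x)`, `m ∈ ℤ`, over the rotation by `α`: it is
`∑_{0 ≤ j < m} f(x + jα)` for `m ≥ 0` and `-∑_{m ≤ j < 0} f(x + jα)` for `m ≤ 0`
(in each case the other sum is empty). -/
def rotSum (α : ℝ) (f : Circ → ℝ) (m : ℤ) (x : Circ) : ℝ :=
  ∑ j ∈ Finset.Ico 0 m, f (x + j • (α : Circ)) - ∑ j ∈ Finset.Ico m 0, f (x + j • (α : Circ))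

theorem rotSum_add_one (α : ℝ) (f : Circ → ℝ) (m : ℤ) (x : Circ) :
    rotSum α f (m + 1) x = rotSum α f m x + f (x + m • (α : Circ)) := by
  unfold rotSum
  rcases lt_or_ge m 0 with hm | hm
  · have h1 : Finset.Ico 0 (m + 1) = ∅ := Finset.Ico_eq_empty (by omega)
    have h2 : Finset.Ico 0 m = ∅ := Finset.Ico_eq_empty (by omega)
    have h3 : Finset.Ico m 0 = insert m (Finset.Ico (m + 1) 0) := by
      ext j; simp only [Finset.mem_Ico, Finset.mem_insert]; omega
    rw [h1, h2, h3, Finset.sum_insert (by simp)]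
    ring
  · have h1 : Finset.Ico (m + 1) 0 = ∅ := Finset.Ico_eq_empty (by omega)
    have h2 : Finset.Ico m 0 = ∅ := Finset.Ico_eq_empty (by omega)
    have h3 : Finset.Ico 0 (m + 1) = insert m (Finset.Ico 0 m) := by
      ext j; simp only [Finset.mem_Ico, Finset.mem_insert]; omega
    rw [h1, h2, h3, Finset.sum_insert (by simp)]
    ring

/-- The phase space `X^f = {(x, s) : 0 ≤ s < f(x)}`, with the trace of the product
`σ`-algebra. -/
abbrev Space (f : Circ → ℝ) : Type := {p : Circ × ℝ // 0 ≤ p.2 ∧ p.2 < f p.1}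

/-- The measure on `X^f`: the restriction of the product of the Lebesgue measures. -/
def spaceMeasure (f : Circ → ℝ) : Measure (Space f) :=
  Measure.comap Subtype.val ((volume : Measure Circ).prod (volume : Measure ℝ))

open Classical in
/-- The special flow `T^f` over the rotation by `α`:
`T^f_t(x, s) = (x + nα, s + t - f^{(n)}(x))`, where `n ∈ ℤ` is the number with
`f^{(n)}(x) ≤ s + t < f^{(n+1)}(x)`. (Such an `n` exists and is unique when `f` is bounded below
by a positive constant; the value in the other case is irrelevant.) -/
def specialFlow (α : ℝ) (f : Circ → ℝ) (t : ℝ) (p : Space f) : Space f :=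
  if h : ∃ n : ℤ, rotSum α f n p.1.1 ≤ p.1.2 + t ∧ p.1.2 + t < rotSum α f (n + 1) p.1.1 then
    ⟨(p.1.1 + h.choose • (α : Circ), p.1.2 + t - rotSum α f h.choose p.1.1), by
      have h' := h.choose_spec
      rw [rotSum_add_one] at h'
      constructor
      · simpa using h'.1
      · have := h'.2
        simp only
        linarith⟩
  else p

/-- Weak mixing of a flow `(S_t)` on `(X, μ)`: every measurable eigenfunction, i.e. every
measurable `g : X → ℂ` with `g ∘ S_t = e^{2πirt} g` almost everywhere for all `t`, for some
`r ∈ ℝ`, is almost everywhere constant (for `r = 0` this is ergodicity). -/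
def IsWeaklyMixing {X : Type*} [MeasurableSpace X] (S : ℝ → X → X) (μ : Measure X) : Prop :=
  ∀ (r : ℝ) (g : X → ℂ), Measurable g →
    (∀ t : ℝ, ∀ᵐ p ∂μ, g (S t p) = Complex.exp (2 * Real.pi * Complex.I * r * t) * g p) →
    ∃ c : ℂ, ∀ᵐ p ∂μ, g p = c

end

end SpecialFlow

/-!
Let `g` be an eigenfunction of the special flow for the frequency `r`. Along the fibres `g` is
determined by its values on one low level (Fubini), which gives a measurable `ψ` on the circle with
`ψ (x + α) = exp (2πir f(x)) ψ(x)` (`exists_transfer_function_of_eigenfunction`). Its modulus is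
constant by ergodicity of the rotation, and for `r = 0` so is `ψ`. It remains to show that for
`r ≠ 0` there is no solution `ψ` of modulus one (`not_exists_transfer_function`).

Write `d_ξ` for the jumps. As they add up to zero, `f(x) = C + ∑ d_ξ {x - ξ}` off the
discontinuities, with `C = ∫ f` (`exists_eq_add_sum_rep`). So the quotient
`ρ(x) = ψ(x + h) / ψ(x)` is multiplied by `exp (-2πir ∑ d_ξ)` along an orbit segment, the sum being
over the discontinuities passed. Take `h = δ/N` and an orbit segment of length comparable to `δN`.
Since `α` is badly approximable (`exists_le_abs_mul_norm_zsmul`), for `x` in the arc of length `h/2`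
centred at `ξ₀ - h/2` (and its translates along the segment) exactly the discontinuities in the
cluster `K` of `ξ₀` are passed, once each: these are the `ξ` that lie much closer than `1/N` to the
orbit segment of `ξ₀`. The translates of the arc cover a positive proportion of the circle, on which
either `ρ(x)` or its value further along the orbit is not close to `1` unless `r ∑_K d_ξ` is an
integer. But `ρ → 1` in `L¹` as `h → 0`, so it is an integer (`exists_int_eq_mul_sum_near`).
Ultrafilters on the set of scales `N` give a clean division into clusters; afterwards, for every
`ε`, all large scales `N` have a partition into `ε`-clusters with integral sums
(`eventually_exists_isIntegralClustering`).

Two rationally related points (difference in `(ℚ + ℚα) \ (ℤ + ℤα)`) are never in the same cluster,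
because such differences are badly approximable by the multiples of `α` as well
(`exists_le_mul_norm_sub_zsmul`); the same holds for clusters through a common point at scales `N`
and `N + 1`. If two such clusters `K`, `K'` have sums `k/r` and `k'/r`, the relation
`k' ∑_K d_ξ - k ∑_{K'} d_ξ = 0` would contradict (P1) if it were nontrivial, so `k ≠ 0` and
`K = K'` (`RelationsSplit.eq_of_integral`). Therefore the clusters do not depend on the scale, and
the points of a cluster lie in one orbit (`exists_setoid_sub_mem_zmultiples`).

Finally, sawtooth functions at points of one orbit are cohomologous, so that `exp (2πirf)` is
cohomologous to a constant, which has to be an eigenvalue `exp (2πilα)` of the rotation. This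
expresses `r ∫ f` through the `r d_ξ` and `ℤ + ℤα` (`exists_const_eq_of_integral_classes`). As `1/r`
is a rational multiple of the sum of jumps over a cluster, (P2) fails.
-/

namespace SpecialFlow

noncomputable section

/-! ### Badly approximable numbers -/

/-- With `t = fract ξ`, the indefinite form `|v t - u| (u + s v) / (t + s)` is invariant under the
Gauss map: it takes the same value at `(u, v)` as the form with `t' = fract t⁻¹`, `s' = ⌊t⁻¹⌋ + s⁻¹`
at `(v - ⌊t⁻¹⌋ u, u)`. Descending along the continued fraction algorithm, one arrives at a pair for
which the lower bound is immediate from the bound `C` on the partial quotients. -/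
theorem add_le_mul_abs_mul_of_partDens_le {C : ℝ} (hC : 1 ≤ C) : ∀ (m : ℕ) (ξ : ℝ), Irrational ξ →
    (∀ (n : ℕ) (a : ℝ), (GenContFract.of ξ).partDens.get? n = some a → a ≤ C) →
    ∀ (s : ℝ), 1 ≤ s → ∀ u v : ℤ, 0 ≤ u → 1 ≤ v → v ≤ m →
      Int.fract ξ + s ≤ (C + 2) * (|v * Int.fract ξ - u| * (u + s * v)) := by
  have key : ∀ ξ : ℝ, Irrational ξ →
      (∀ (n : ℕ) (a : ℝ), (GenContFract.of ξ).partDens.get? n = some a → a ≤ C) →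
      0 < Int.fract ξ ∧ Int.fract ξ < 1 ∧ Irrational (Int.fract ξ)⁻¹ ∧
      (∀ (n : ℕ) (a : ℝ), (GenContFract.of (Int.fract ξ)⁻¹).partDens.get? n = some a → a ≤ C) ∧
      1 ≤ ⌊(Int.fract ξ)⁻¹⌋ ∧ (⌊(Int.fract ξ)⁻¹⌋ : ℝ) ≤ C := by
    intro ξ hξ hb
    have h0 : Int.fract ξ ≠ 0 := by
      intro h
      rw [Int.fract_eq_iff] at h
      obtain ⟨-, -, z, hz⟩ := h
      exact hξ ⟨z, by push_cast; linarith⟩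
    have hpos : 0 < Int.fract ξ := lt_of_le_of_ne (Int.fract_nonneg ξ) (Ne.symm h0)
    refine ⟨hpos, Int.fract_lt_one ξ, ?_, ?_, ?_, ?_⟩
    · have : Irrational (Int.fract ξ) := by
        rw [← Int.self_sub_floor]; exact hξ.sub_intCast _
      exact irrational_inv_iff.2 this
    · intro n a ha
      refine hb (n + 1) a ?_
      simpa [GenContFract.partDens, Stream'.Seq.map_get?, GenContFract.of_s_succ] using ha
    · rw [Int.le_floor]; push_cast
      exact (one_le_inv₀ hpos).2 (Int.fract_lt_one ξ).le
    · refine hb 0 _ ?_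
      have := GenContFract.of_s_head h0
      rw [Stream'.Seq.head] at this
      simp [GenContFract.partDens, Stream'.Seq.map_get?, this]
  intro m
  induction m with
  | zero => intro ξ _ _ s _ u v _ h1 h2; exfalso; push_cast at h2; omega
  | succ m ih =>
    intro ξ hξ hb s hs u v hu hv hvm
    obtain ⟨ht0, ht1, hξ', hb', ha1, haC⟩ := key ξ hξ hb
    obtain ⟨ht0', ht1', -, -, ha1', haC'⟩ := key _ hξ' hb'
    set t := Int.fract ξ with ht
    set a := ⌊t⁻¹⌋ with ha
    have hat : t⁻¹ = a + Int.fract t⁻¹ := (Int.floor_add_fract _).symm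
    set t' := Int.fract t⁻¹ with ht'
    have hat' : t'⁻¹ = ⌊t'⁻¹⌋ + Int.fract t'⁻¹ := (Int.floor_add_fract _).symm
    have hf1 := Int.fract_lt_one t'⁻¹
    -- bounded partial quotients keep `t` and `t'` away from zero
    have hlow : 1 < (C + 1) * t := by
      have h2 : t⁻¹ < C + 1 := by linarith
      have := mul_lt_mul_of_pos_right h2 ht0
      rwa [inv_mul_cancel₀ ht0.ne'] at this
    have hlow' : 1 < (C + 1) * t' := by
      have h2 : t'⁻¹ < C + 1 := by linarith
      have := mul_lt_mul_of_pos_right h2 ht0'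
      rwa [inv_mul_cancel₀ ht0'.ne'] at this
    have h1t : 1 = t * (a + t') := by rw [← hat, mul_inv_cancel₀ ht0.ne']
    have haR : (1 : ℝ) ≤ a := by exact_mod_cast ha1
    have hvR : (1 : ℝ) ≤ v := by exact_mod_cast hv
    have huR : (0 : ℝ) ≤ u := by exact_mod_cast hu
    rcases hu.eq_or_lt with hu0 | hu0
    · rw [← hu0]
      simp only [Int.cast_zero, sub_zero, zero_add]
      rw [abs_of_nonneg (by positivity)]
      have h1 : t + s ≤ (C + 2) * (t * s) := by nlinarith
      have h2 : t * s ≤ (v * t) * (s * v) := by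
        have : (1 : ℝ) ≤ v * v := by nlinarith
        nlinarith [mul_pos ht0 (by linarith : (0:ℝ) < s)]
      nlinarith
    have hu1 : (1 : ℝ) ≤ u := by exact_mod_cast hu0
    have hus : 1 + s ≤ u + s * v := by nlinarith
    rcases le_or_gt v u with huv | huv
    · have huvR : (v : ℝ) ≤ u := by exact_mod_cast huv
      have h3 : 1 - t ≤ |v * t - u| := by
        rw [abs_sub_comm]
        refine le_trans ?_ (le_abs_self _)
        nlinarith
      have h4 : 1 ≤ (C + 2) * (1 - t) := by
        -- `t (1 + t') ≤ 1` and `t' > 1 / (C + 1)`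
        have : t * (1 + t') ≤ 1 := by nlinarith
        nlinarith
      calc t + s ≤ 1 * (1 + s) := by linarith
        _ ≤ ((C + 2) * |v * t - u|) * (u + s * v) := by
          apply mul_le_mul _ hus (by linarith) (by positivity)
          nlinarith
        _ = _ := by ring
    · have hvt : (v * t - u : ℝ) = t * ((v - a * u) - u * t') := by
        linear_combination (-(u : ℝ)) * h1t
      rcases le_or_gt 0 (v - a * u) with hw | hw
      -- the descent step, from `(u, v)` to `(v - a u, u)`
      · have := ih t⁻¹ hξ' hb' (a + s⁻¹) (by have := inv_pos.2 (by linarith : 0 < s); linarith)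
          (v - a * u) u hw (by omega) (by push_cast at hvm; omega)
        have hs0 : 0 < s := by linarith
        have h5 : t + s = (t * s) * (t' + (a + s⁻¹)) := by
          field_simp
          linear_combination s * h1t
        have h6 : |v * t - u| * (u + s * v) = (t * s) *
            (|u * t' - (v - a * u : ℤ)| * ((v - a * u : ℤ) + (a + s⁻¹) * u)) := by
          rw [hvt, abs_mul, abs_of_pos ht0, abs_sub_comm ((v : ℝ) - a * u)]
          push_cast
          field_simp
          ring
        rw [h5, h6]
        have := mul_le_mul_of_nonneg_left this (by positivity : 0 ≤ t * s)
        linarith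
      · have hwR : ((v : ℝ) - a * u) ≤ -1 := by
          have : v - a * u ≤ -1 := by omega
          exact_mod_cast this
        have h7 : t ≤ |v * t - u| := by
          rw [hvt, abs_mul, abs_of_pos ht0, abs_sub_comm]
          have : 1 ≤ |u * t' - ((v : ℝ) - a * u)| := le_trans (by nlinarith) (le_abs_self _)
          nlinarith
        calc t + s ≤ 1 * (1 + s) := by linarith
          _ ≤ ((C + 2) * |v * t - u|) * (u + s * v) := by
            apply mul_le_mul _ hus (by linarith) (by positivity)
            nlinarith
          _ = _ := by ring

/-- An irrational number with bounded partial quotients is badly approximable. -/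
theorem exists_le_abs_mul_norm_zsmul {α : ℝ} (hα : Irrational α)
    (h : HasBoundedPartialQuotients α) :
    ∃ c : ℝ, 0 < c ∧ ∀ m : ℤ, m ≠ 0 → c ≤ |(m : ℝ)| * ‖m • (α : Circ)‖ := by
  obtain ⟨C₀, hC₀⟩ := h
  set C := max C₀ 1 with hCdef
  have hC1 : 1 ≤ C := le_max_right _ _
  have hC : ∀ (n : ℕ) (a : ℝ), (GenContFract.of α).partDens.get? n = some a → a ≤ C :=
    fun n a ha => (hC₀ n a ha).trans (le_max_left _ _)
  refine ⟨1 / (3 * (C + 2)), by positivity, ?_⟩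
  have hpos : ∀ m : ℤ, 0 < m → 1 / (3 * (C + 2)) ≤ |(m : ℝ)| * ‖m • (α : Circ)‖ := by
    intro v hv
    have hvR : (1 : ℝ) ≤ v := by exact_mod_cast hv
    have e : v • (α : Circ) = ((v * Int.fract α : ℝ) : Circ) := by
      rw [← AddCircle.coe_fract α, ← AddCircle.coe_zsmul, zsmul_eq_mul]
    rw [e, UnitAddCircle.norm_eq, abs_of_pos (by linarith : (0 : ℝ) < v)]
    set u := round (v * Int.fract α) with hu
    have h13 : 1 / (3 * (C + 2)) ≤ 1 := by
      rw [div_le_one (by positivity)]; linarith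
    have hf0 := Int.fract_nonneg α
    have hf1 := Int.fract_lt_one α
    rcases lt_or_ge u 0 with hu0 | hu0
    · have huR : (u : ℝ) ≤ -1 := by
        have : u ≤ -1 := by omega
        exact_mod_cast this
      have : 1 ≤ |v * Int.fract α - u| := le_trans (by nlinarith) (le_abs_self _)
      nlinarith
    have huR : (0 : ℝ) ≤ u := by exact_mod_cast hu0
    rcases le_or_gt (2 * (v : ℝ)) u with hu2 | hu2
    · have : 1 ≤ |v * Int.fract α - u| := by
        rw [abs_sub_comm]
        exact le_trans (by nlinarith) (le_abs_self _)
      nlinarith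
    · have := add_le_mul_abs_mul_of_partDens_le hC1 v.toNat α hα hC 1 le_rfl u v hu0 hv (by omega)
      have h3 : |v * Int.fract α - u| * (u + 1 * v) ≤ |v * Int.fract α - u| * (3 * v) :=
        mul_le_mul_of_nonneg_left (by linarith) (abs_nonneg _)
      rw [div_le_iff₀ (by positivity)]
      nlinarith
  intro m hm
  rcases hm.lt_or_gt with h | h
  · have := hpos (-m) (by omega)
    simpa [neg_smul, norm_neg] using this
  · exact hpos m h

theorem mem_intSpan_iff {α : ℝ} {x : Circ} : x ∈ intSpan α ↔ ∃ b : ℤ, x = b • (α : Circ) := by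
  constructor
  · rintro ⟨k, l, rfl⟩
    refine ⟨l, ?_⟩
    rw [← AddCircle.coe_zsmul, zsmul_eq_mul, AddCircle.coe_add]
    have : ((k : ℝ) : Circ) = 0 := AddCircle.coe_eq_zero_iff 1 |>.2 ⟨k, by simp⟩
    rw [this, zero_add]
  · rintro ⟨b, rfl⟩
    exact ⟨0, b, by rw [← AddCircle.coe_zsmul, zsmul_eq_mul]; simp⟩

/-- For badly approximable `α`, the points of `(ℚ + ℚα) \ (ℤ + ℤα)` are badly approximable by the
multiples of `α`. -/
theorem exists_le_mul_norm_sub_zsmul {α c : ℝ} (hc : 0 < c)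
    (hα : ∀ m : ℤ, m ≠ 0 → c ≤ |(m : ℝ)| * ‖m • (α : Circ)‖)
    {β : Circ} (hβ : β ∈ ratSpan α \ intSpan α) :
    ∃ κ : ℝ, 0 < κ ∧ ∀ N : ℕ, 1 ≤ N → ∀ b : ℤ, |(b : ℝ)| ≤ N →
      κ ≤ N * ‖β - b • (α : Circ)‖ := by
  obtain ⟨⟨q, r, hqr⟩, hint⟩ := hβ
  rw [mem_intSpan_iff] at hint
  push Not at hint
  obtain ⟨D, B, hD, hDB⟩ : ∃ D B : ℤ, 0 < D ∧ D • β = B • (α : Circ) := by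
    refine ⟨q.den * r.den, r.num * q.den, by positivity, ?_⟩
    rw [hqr, ← AddCircle.coe_zsmul, ← AddCircle.coe_zsmul, ← sub_eq_zero, ← AddCircle.coe_sub,
      AddCircle.coe_eq_zero_iff]
    refine ⟨q.num * r.den, ?_⟩
    have h1 : (q : ℝ) * q.den = q.num := by exact_mod_cast Rat.mul_den_eq_num q
    have h2 : (r : ℝ) * r.den = r.num := by exact_mod_cast Rat.mul_den_eq_num r
    simp only [zsmul_eq_mul, mul_one]
    push_cast
    rw [← h1, ← h2]
    ring
  have hDR : (0 : ℝ) < D := by exact_mod_cast hD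
  -- multiplying by `D` turns `β - b α` into the nonzero multiple `(B - b D) α`
  have main : ∀ N : ℕ, 1 ≤ N → ∀ b : ℤ, |(b : ℝ)| ≤ N → B - b * D ≠ 0 →
      c / (D * (|(B : ℝ)| + D)) ≤ N * ‖β - b • (α : Circ)‖ := by
    intro N hN b hb hne
    have hNR : (1 : ℝ) ≤ N := by exact_mod_cast hN
    have h1 := hα _ hne
    have h2 : (B - b * D) • (α : Circ) = D • (β - b • (α : Circ)) := by
      rw [sub_smul, smul_sub, hDB, mul_comm b D, mul_smul]
    have h3 : ‖(B - b * D) • (α : Circ)‖ ≤ D * ‖β - b • (α : Circ)‖ := by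
      rw [h2]
      refine (norm_zsmul_le _ _).trans (le_of_eq ?_)
      simp [Int.norm_eq_abs, abs_of_pos hDR]
    have h4 : |((B - b * D : ℤ) : ℝ)| ≤ (|(B : ℝ)| + D) * N := by
      push_cast
      refine (abs_sub _ _).trans ?_
      rw [abs_mul, abs_of_pos hDR]
      nlinarith [abs_nonneg (B : ℝ)]
    rw [div_le_iff₀ (by positivity)]
    calc c ≤ _ := h1
      _ ≤ ((|(B : ℝ)| + D) * N) * (D * ‖β - b • (α : Circ)‖) := by gcongr
      _ = _ := by ring
  by_cases hex : ∃ b₀ : ℤ, B = b₀ * D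
  · obtain ⟨b₀, hb₀⟩ := hex
    have h0 : 0 < ‖β - b₀ • (α : Circ)‖ := norm_pos_iff.2 (sub_ne_zero.2 (hint b₀))
    refine ⟨min (c / (D * (|(B : ℝ)| + D))) ‖β - b₀ • (α : Circ)‖,
      lt_min (by positivity) h0, fun N hN b hb => ?_⟩
    have hNR : (1 : ℝ) ≤ N := by exact_mod_cast hN
    by_cases hbb : B - b * D = 0
    · have : b = b₀ := by
        have : b * D = b₀ * D := by omega
        exact mul_right_cancel₀ hD.ne' this
      subst this
      refine (min_le_right _ _).trans ?_
      nlinarith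
    · exact (min_le_left _ _).trans (main N hN b hb hbb)
  · push Not at hex
    exact ⟨_, by positivity, fun N hN b hb =>
      main N hN b hb (fun h => hex b (by omega))⟩

/-! ### Piecewise constant functions on the circle -/

theorem rep_nonneg (x : Circ) : 0 ≤ rep x := (AddCircle.equivIco (1 : ℝ) 0 x).2.1

theorem rep_lt_one (x : Circ) : rep x < 1 :=
  (AddCircle.equivIco (1 : ℝ) 0 x).2.2.trans_eq (zero_add 1)

theorem coe_rep (x : Circ) : ((rep x : ℝ) : Circ) = x := AddCircle.coe_equivIco

theorem rep_coe_of_nonneg {t : ℝ} (h0 : 0 ≤ t) (h1 : t < 1) : rep (t : Circ) = t :=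
  AddCircle.equivIco_coe_of_mem ⟨h0, by simpa using h1⟩

theorem coe_add_one (t : ℝ) : ((t + 1 : ℝ) : Circ) = (t : Circ) := AddCircle.coe_add_period 1 t

theorem rep_coe_of_neg {t : ℝ} (h0 : -1 ≤ t) (h1 : t < 0) : rep (t : Circ) = t + 1 := by
  rw [← coe_add_one, rep_coe_of_nonneg (by linarith) (by linarith)]

theorem measurable_rep : Measurable rep :=
  measurable_subtype_coe.comp (AddCircle.measurableEquivIco (1 : ℝ) 0).measurable

theorem exists_coe_eq_abs_eq_norm (y : Circ) : ∃ t : ℝ, (t : Circ) = y ∧ |t| = ‖y‖ := by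
  refine ⟨rep y - round (rep y), ?_, ?_⟩
  · rw [AddCircle.coe_sub, coe_rep]
    have : ((round (rep y) : ℝ) : Circ) = 0 :=
      (AddCircle.coe_eq_zero_iff 1).2 ⟨round (rep y), by simp⟩
    rw [this, sub_zero]
  · rw [← UnitAddCircle.norm_eq, coe_rep]

theorem norm_coe_le_abs (t : ℝ) : ‖(t : Circ)‖ ≤ |t| := by
  rw [UnitAddCircle.norm_eq]
  simpa using round_le t 0

theorem coe_ne_zero_of_abs_lt {t : ℝ} (h0 : t ≠ 0) (h1 : |t| < 1) : (t : Circ) ≠ 0 := by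
  intro h
  obtain ⟨n, hn⟩ := (AddCircle.coe_eq_zero_iff 1).1 h
  simp only [zsmul_eq_mul, mul_one] at hn
  rw [← hn] at h1 h0
  have : |n| < 1 := by exact_mod_cast h1
  rw [Int.abs_lt_one_iff] at this
  simp [this] at h0

theorem integral_rep_sub (ξ : Circ) : ∫ x, rep (x - ξ) = 1 / 2 := by
  rw [integral_sub_right_eq_self (μ := (volume : Measure Circ)) rep ξ,
    ← UnitAddCircle.intervalIntegral_preimage 0 rep, zero_add]
  have : ∫ a in (0 : ℝ)..1, rep (a : Circ) = ∫ a in (0 : ℝ)..1, a := by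
    refine intervalIntegral.integral_congr_ae ?_
    have h1 : ∀ᵐ a : ℝ, a ≠ 1 := by simp [ae_iff]
    filter_upwards [h1] with a ha ha'
    rw [Set.uIoc_of_le zero_le_one] at ha'
    exact rep_coe_of_nonneg ha'.1.le (lt_of_le_of_ne ha'.2 ha)
  rw [this, integral_id]
  norm_num

theorem integrable_rep_sub (ξ : Circ) : Integrable (fun x : Circ => rep (x - ξ)) := by
  refine Integrable.of_bound (measurable_rep.comp (measurable_id.sub_const ξ)).aestronglyMeasurable
    1 (ae_of_all _ fun x => ?_)
  rw [Real.norm_eq_abs, abs_of_nonneg (rep_nonneg _)]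
  exact (rep_lt_one _).le

/-- `crossing h y` says that the arc from `y` to `y + h` passes through `0`: `0 ∈ (y, y + h]`. -/
def crossing (h : ℝ) (y : Circ) : Prop := ∃ t ∈ Set.Ico (-h) 0, y = (t : Circ)

open Classical in
theorem rep_add_coe {h : ℝ} (h0 : 0 ≤ h) (h1 : h < 1) (y : Circ) :
    rep (y + (h : Circ)) = rep y + h - if crossing h y then 1 else 0 := by
  have hy0 := rep_nonneg y
  have hy1 := rep_lt_one y
  have e : y + (h : Circ) = ((rep y + h : ℝ) : Circ) := by rw [AddCircle.coe_add, coe_rep]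
  rcases lt_or_ge (rep y + h) 1 with hlt | hge
  · rw [if_neg, e, rep_coe_of_nonneg (by linarith) hlt, sub_zero]
    rintro ⟨t, ⟨ht1, ht2⟩, rfl⟩
    rw [rep_coe_of_neg (by linarith) ht2] at hlt
    linarith
  · rw [if_pos, e, ← sub_add_cancel (rep y + h) 1, coe_add_one,
      rep_coe_of_nonneg (by linarith) (by linarith)]
    · ring
    · refine ⟨rep y - 1, ⟨by linarith, by linarith⟩, ?_⟩
      rw [← coe_add_one, sub_add_cancel, coe_rep]

theorem tendsto_add_coe (x : Circ) : Tendsto (fun t : ℝ => x + (t : Circ)) (𝓝 0) (𝓝 x) := by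
  have : Continuous (fun t : ℝ => x + (t : Circ)) :=
    continuous_const.add (AddCircle.continuous_mk' 1)
  simpa using this.tendsto 0

theorem eventually_nhds_of_eventually_add_coe {x : Circ} {P : Circ → Prop}
    (h : ∀ᶠ t : ℝ in 𝓝 0, P (x + (t : Circ))) : ∀ᶠ y in 𝓝 x, P y := by
  rw [Metric.eventually_nhds_iff] at h ⊢
  obtain ⟨δ, hδ, h⟩ := h
  refine ⟨δ, hδ, fun y hy => ?_⟩
  obtain ⟨t, ht, htn⟩ := exists_coe_eq_abs_eq_norm (y - x)
  have := h (y := t) (by rwa [dist_zero_right, Real.norm_eq_abs, htn, ← dist_eq_norm])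
  rwa [ht, add_sub_cancel] at this

theorem tendsto_add_coe_nhdsNE (x : Circ) :
    Tendsto (fun t : ℝ => x + (t : Circ)) (𝓝[>] 0) (𝓝[≠] x) := by
  refine tendsto_nhdsWithin_iff.2 ⟨(tendsto_add_coe x).mono_left nhdsWithin_le_nhds, ?_⟩
  filter_upwards [Ioo_mem_nhdsGT (zero_lt_one (α := ℝ))] with t ht
  simpa using coe_ne_zero_of_abs_lt ht.1.ne' (by rw [abs_of_pos ht.1]; exact ht.2)

theorem eventually_rep_add_coe {y : Circ} (hy : y ≠ 0) :
    ∀ᶠ t : ℝ in 𝓝 0, rep (y + (t : Circ)) = rep y + t := by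
  have hy0 : 0 < rep y := by
    refine lt_of_le_of_ne (rep_nonneg y) fun h => hy ?_
    rw [← coe_rep y, ← h, AddCircle.coe_zero]
  have hy1 := rep_lt_one y
  filter_upwards [Ioo_mem_nhds (a := -rep y) (b := 1 - rep y) (x := 0) (by linarith) (by linarith)]
    with t ht
  rw [← coe_rep y, ← AddCircle.coe_add, rep_coe_of_nonneg (by linarith [ht.1])
    (by linarith [ht.2]), rep_coe_of_nonneg hy0.le hy1]

open Classical in
theorem eventually_rep_add_sub_left (x ξ : Circ) :
    ∀ᶠ t : ℝ in 𝓝[<] 0, rep (x + (t : Circ) - ξ) = rep (x - ξ) + t + if ξ = x then 1 else 0 := by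
  by_cases h : ξ = x
  · subst h
    filter_upwards [Ioo_mem_nhdsLT (a := -1) (b := (0 : ℝ)) (by norm_num)] with t ht
    rw [add_sub_cancel_left, sub_self, if_pos rfl, rep_coe_of_neg ht.1.le ht.2]
    have : rep 0 = 0 := rep_coe_of_nonneg le_rfl one_pos
    rw [this]; ring
  · filter_upwards [nhdsWithin_le_nhds (eventually_rep_add_coe (sub_ne_zero.2 (Ne.symm h)))]
      with t ht
    rw [if_neg h, add_zero, ← ht]; congr 1; abel

theorem eventually_rep_add_sub_right (x ξ : Circ) :
    ∀ᶠ t : ℝ in 𝓝[>] 0, rep (x + (t : Circ) - ξ) = rep (x - ξ) + t := by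
  by_cases h : ξ = x
  · subst h
    filter_upwards [Ioo_mem_nhdsGT (zero_lt_one (α := ℝ))] with t ht
    rw [add_sub_cancel_left, sub_self, rep_coe_of_nonneg ht.1.le ht.2]
    have : rep 0 = 0 := rep_coe_of_nonneg le_rfl one_pos
    rw [this]; ring
  · filter_upwards [nhdsWithin_le_nhds (eventually_rep_add_coe (sub_ne_zero.2 (Ne.symm h)))]
      with t ht
    rw [← ht]; congr 1; abel

/-- A function that is locally constant off a finite set is constant on a one-sided punctured
neighbourhood of each point, because such a neighbourhood may be taken connected and free of
exceptional points. -/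
theorem IsPiecewiseConstant.exists_eventually_eq {f : Circ → ℝ} (hf : IsPiecewiseConstant f)
    (x : Circ) : (∃ L, ∀ᶠ t : ℝ in 𝓝[<] 0, f (x + (t : Circ)) = L) ∧
      ∃ R, ∀ᶠ t : ℝ in 𝓝[>] 0, f (x + (t : Circ)) = R := by
  obtain ⟨S, hS, hloc⟩ := hf
  have h1 : ∀ᶠ y in 𝓝 x, y ∉ S \ {x} :=
    (hS.subset Set.sdiff_subset).isClosed.isOpen_compl.mem_nhds (by simp)
  obtain ⟨δ, hδ, hball⟩ := Metric.eventually_nhds_iff.1 ((tendsto_add_coe x).eventually h1)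
  set ε := min δ 1 with hε
  have hε0 : 0 < ε := lt_min hδ one_pos
  have h2 : ∀ t : ℝ, t ≠ 0 → |t| < ε → x + (t : Circ) ∉ S := by
    intro t ht0 ht hmem
    have := hball (y := t) (by simpa [Real.dist_eq] using ht.trans_le (min_le_left _ _))
    refine this ⟨hmem, ?_⟩
    simpa using coe_ne_zero_of_abs_lt ht0 (ht.trans_le (min_le_right _ _))
  have hder : ∀ t : ℝ, t ≠ 0 → |t| < ε → HasDerivAt (fun t : ℝ => f (x + (t : Circ))) 0 t := by
    intro t ht0 ht
    have hc : Tendsto (fun s : ℝ => x + (s : Circ)) (𝓝 t) (𝓝 (x + (t : Circ))) :=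
      (continuous_const.add (AddCircle.continuous_mk' 1)).tendsto t
    exact (hasDerivAt_const t (f (x + (t : Circ)))).congr_of_eventuallyEq
      (hc.eventually (hloc _ (h2 t ht0 ht)))
  have hconst : ∀ s : Set ℝ, IsOpen s → IsPreconnected s → (∀ t ∈ s, t ≠ 0 ∧ |t| < ε) →
      ∀ a ∈ s, ∀ b ∈ s, f (x + (a : Circ)) = f (x + (b : Circ)) := by
    intro s hs hs' hsub a ha b hb
    exact hs.is_const_of_deriv_eq_zero (f := fun t : ℝ => f (x + (t : Circ))) hs'
      (fun t ht => (hder t (hsub t ht).1 (hsub t ht).2).differentiableAt.differentiableWithinAt)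
      (fun t ht => (hder t (hsub t ht).1 (hsub t ht).2).deriv) ha hb
  constructor
  · refine ⟨f (x + ((-(ε / 2) : ℝ) : Circ)), ?_⟩
    filter_upwards [Ioo_mem_nhdsLT (a := -ε) (b := (0 : ℝ)) (by linarith)] with t ht
    refine hconst (Set.Ioo (-ε) 0) isOpen_Ioo isPreconnected_Ioo (fun t ht => ⟨ht.2.ne, ?_⟩)
      t ht _ ⟨by linarith, by linarith⟩
    rw [abs_lt]; exact ⟨ht.1, ht.2.trans hε0⟩
  · refine ⟨f (x + ((ε / 2 : ℝ) : Circ)), ?_⟩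
    filter_upwards [Ioo_mem_nhdsGT hε0] with t ht
    refine hconst (Set.Ioo 0 ε) isOpen_Ioo isPreconnected_Ioo (fun t ht => ⟨ht.1.ne', ?_⟩)
      t ht _ ⟨by linarith, by linarith⟩
    rw [abs_lt]; exact ⟨by linarith [ht.1], ht.2⟩

theorem IsPiecewiseConstant.exists_pos_le {f : Circ → ℝ} (hf : IsPiecewiseConstant f)
    (hpos : ∀ x, 0 < f x) : ∃ a, 0 < a ∧ ∀ x, a ≤ f x := by
  have hloc : ∀ x, ∃ a, 0 < a ∧ ∀ᶠ y in 𝓝 x, a ≤ f y := by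
    intro x
    obtain ⟨⟨L, hL⟩, R, hR⟩ := hf.exists_eventually_eq x
    obtain ⟨t, ht⟩ := hL.exists
    obtain ⟨t', ht'⟩ := hR.exists
    have hL0 : 0 < L := ht ▸ hpos _
    have hR0 : 0 < R := ht' ▸ hpos _
    refine ⟨min (f x) (min L R), lt_min (hpos x) (lt_min hL0 hR0), ?_⟩
    refine eventually_nhds_of_eventually_add_coe ?_
    rw [eventually_nhdsWithin_iff] at hL hR
    filter_upwards [hL, hR] with t hl hr
    rcases lt_trichotomy t 0 with h | h | h
    · rw [hl h]; simp
    · simp [h]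
    · rw [hr h]; simp
  choose a ha hle using hloc
  obtain ⟨T, hT⟩ := isCompact_univ.elim_nhds_subcover (fun x => {y | a x ≤ f y})
    (fun x _ => hle x)
  have hTne : T.Nonempty := by
    obtain ⟨i, hi, -⟩ := Set.mem_iUnion₂.1 (hT.2 (Set.mem_univ (0 : Circ)))
    exact ⟨i, hi⟩
  refine ⟨T.inf' hTne a, (Finset.lt_inf'_iff hTne).2 fun i _ => ha i, fun x => ?_⟩
  obtain ⟨i, hi, hx⟩ := Set.mem_iUnion₂.1 (hT.2 (Set.mem_univ x))
  exact (Finset.inf'_le a hi).trans hx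

theorem jump_eq_sub {f : Circ → ℝ} {x : Circ} {L R : ℝ}
    (hL : ∀ᶠ t : ℝ in 𝓝[<] 0, f (x + (t : Circ)) = L)
    (hR : ∀ᶠ t : ℝ in 𝓝[>] 0, f (x + (t : Circ)) = R) : jump f x = L - R := by
  unfold jump leftLimit rightLimit
  rw [(tendsto_const_nhds.congr' (hL.mono fun _ h => h.symm)).limUnder_eq,
    (tendsto_const_nhds.congr' (hR.mono fun _ h => h.symm)).limUnder_eq]

theorem jump_eq_zero_of_continuousAt {f : Circ → ℝ} (x : Circ)
    (hc : ContinuousAt f x) : jump f x = 0 := by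
  have h := hc.tendsto.comp (tendsto_add_coe x)
  unfold jump leftLimit rightLimit
  exact sub_eq_zero.2 ((Tendsto.limUnder_eq (h.mono_left nhdsWithin_le_nhds)).trans
    (Tendsto.limUnder_eq (h.mono_left nhdsWithin_le_nhds)).symm)

/-- A piecewise constant function whose jumps `d_ξ` add up to zero is a constant plus a combination
of sawtooth functions: the difference is locally constant off a finite set, and has no
jumps. -/
theorem exists_eq_add_sum_rep {f : Circ → ℝ} (hpc : IsPiecewiseConstant f)
    {Ξ : Finset Circ} (hΞ : ∀ x, x ∈ Ξ ↔ ¬ ContinuousAt f x)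
    (hsum : ∑ ξ ∈ Ξ, jump f ξ = 0) :
    ∃ C : ℝ, ∀ x ∉ Ξ, f x = C + ∑ ξ ∈ Ξ, jump f ξ * rep (x - ξ) := by
  classical
  set g : Circ → ℝ := fun x => f x - ∑ ξ ∈ Ξ, jump f ξ * rep (x - ξ) with hg
  have hv : ∀ x, ∃ v, ∀ᶠ y in 𝓝[≠] x, g y = v := by
    intro x
    obtain ⟨⟨L, hL⟩, R, hR⟩ := hpc.exists_eventually_eq x
    have hj := jump_eq_sub hL hR
    have hjs : ∑ ξ ∈ Ξ, (if ξ = x then jump f ξ else 0) = L - R := by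
      rw [Finset.sum_ite_eq', ← hj]
      split_ifs with h
      · rfl
      · rw [hΞ, not_not] at h
        exact (jump_eq_zero_of_continuousAt x h).symm
    refine ⟨R - ∑ ξ ∈ Ξ, jump f ξ * rep (x - ξ), ?_⟩
    have hl : ∀ᶠ t : ℝ in 𝓝[<] 0, g (x + (t : Circ)) = R - ∑ ξ ∈ Ξ, jump f ξ * rep (x - ξ) := by
      filter_upwards [hL, (eventually_all_finset Ξ).2
        fun ξ _ => eventually_rep_add_sub_left x ξ] with t ht ht'
      have : ∑ ξ ∈ Ξ, jump f ξ * rep (x + (t : Circ) - ξ) =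
          ∑ ξ ∈ Ξ, (jump f ξ * rep (x - ξ) + jump f ξ * t + if ξ = x then jump f ξ else 0) := by
        refine Finset.sum_congr rfl fun ξ hξ => ?_
        rw [ht' ξ hξ]; split_ifs <;> ring
      simp only [hg, ht, this, Finset.sum_add_distrib, ← Finset.sum_mul, hsum, hjs]
      ring
    have hr : ∀ᶠ t : ℝ in 𝓝[>] 0, g (x + (t : Circ)) = R - ∑ ξ ∈ Ξ, jump f ξ * rep (x - ξ) := by
      filter_upwards [hR, (eventually_all_finset Ξ).2
        fun ξ _ => eventually_rep_add_sub_right x ξ] with t ht ht'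
      have : ∑ ξ ∈ Ξ, jump f ξ * rep (x + (t : Circ) - ξ) =
          ∑ ξ ∈ Ξ, (jump f ξ * rep (x - ξ) + jump f ξ * t) := by
        refine Finset.sum_congr rfl fun ξ hξ => ?_
        rw [ht' ξ hξ]; ring
      simp only [hg, ht, this, Finset.sum_add_distrib, ← Finset.sum_mul, hsum]
      ring
    have hlr : ∀ᶠ t : ℝ in 𝓝[≠] 0, g (x + (t : Circ)) = R - ∑ ξ ∈ Ξ, jump f ξ * rep (x - ξ) := by
      rw [← Set.Iio_union_Ioi, nhdsWithin_union]
      exact eventually_sup.2 ⟨hl, hr⟩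
    rw [eventually_nhdsWithin_iff] at hlr ⊢
    refine eventually_nhds_of_eventually_add_coe (hlr.mono fun t ht hne => ht ?_)
    rintro rfl
    exact hne (by simp)
  choose v hv using hv
  have hvl : IsLocallyConstant v := by
    rw [IsLocallyConstant.iff_eventually_eq]
    intro x
    have h1 := eventually_eventually_nhdsWithin.2 (hv x)
    rw [eventually_nhdsWithin_iff] at h1
    filter_upwards [h1] with y hy
    by_cases hyx : y = x
    · rw [hyx]
    · have h2 := hy hyx
      rw [isOpen_compl_singleton.nhdsWithin_eq (by exact hyx)] at h2
      have := (tendsto_add_coe_nhdsNE y).neBot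
      obtain ⟨z, hz1, hz2⟩ := ((hv y).and (nhdsWithin_le_nhds h2)).exists
      rw [← hz1, ← hz2]
  obtain ⟨C, hC⟩ : ∃ C, ∀ x, v x = C := ⟨v 0, fun x => hvl.apply_eq_of_isPreconnected
    isPreconnected_univ (Set.mem_univ x) (Set.mem_univ 0)⟩
  refine ⟨C, fun x hx => ?_⟩
  -- at a continuity point, `g` is continuous, so its value is its limit
  have hgc : Tendsto (fun t : ℝ => g (x + (t : Circ))) (𝓝[>] 0) (𝓝 (g x)) := by
    have h1 : ContinuousAt f x := by by_contra h; exact hx ((hΞ x).2 h)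
    have h2 : Tendsto (fun t : ℝ => ∑ ξ ∈ Ξ, jump f ξ * rep (x + (t : Circ) - ξ)) (𝓝[>] 0)
        (𝓝 (∑ ξ ∈ Ξ, jump f ξ * rep (x - ξ))) := by
      refine tendsto_finsetSum _ fun ξ hξ => Tendsto.const_mul _ ?_
      have h3 : Tendsto (fun t : ℝ => rep (x - ξ) + t) (𝓝[>] 0) (𝓝 (rep (x - ξ) + 0)) :=
        tendsto_const_nhds.add (tendsto_id.mono_left nhdsWithin_le_nhds)
      rw [add_zero] at h3
      exact h3.congr' ((eventually_rep_add_sub_right x ξ).mono fun t ht => ht.symm)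
    exact ((h1.tendsto.comp (tendsto_add_coe x)).mono_left nhdsWithin_le_nhds).sub h2
  have hgC : Tendsto (fun t : ℝ => g (x + (t : Circ))) (𝓝[>] 0) (𝓝 C) := by
    refine tendsto_const_nhds.congr' ?_
    filter_upwards [(tendsto_add_coe_nhdsNE x).eventually (hv x)] with t ht
    rw [ht, hC]
  have := tendsto_nhds_unique hgc hgC
  simp only [hg] at this
  linarith

theorem measurable_of_eq_add_sum_rep {f d : Circ → ℝ} {Ξ : Finset Circ} {C : ℝ}
    (h : ∀ x ∉ Ξ, f x = C + ∑ ξ ∈ Ξ, d ξ * rep (x - ξ)) : Measurable f := by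
  have hm : Measurable fun x : Circ => C + ∑ ξ ∈ Ξ, d ξ * rep (x - ξ) :=
    measurable_const.add (Finset.measurable_fun_sum _ fun ξ _ =>
      (measurable_rep.comp (measurable_id.sub_const ξ)).const_mul _)
  refine hm.measurable_of_countable_ne (Ξ.countable_toSet.mono fun x hx => ?_)
  by_contra hx'
  exact hx (h x hx').symm

theorem ae_notMem_finset (Ξ : Finset Circ) : ∀ᵐ x : Circ, x ∉ Ξ := by
  have : NullSingletonClass (volume : Measure Circ) := by
    refine ⟨fun x => ?_⟩
    rw [← Metric.closedBall_zero, AddCircle.volume_closedBall]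
    simp
  exact Ξ.countable_toSet.ae_notMem _

theorem integral_eq_of_eq_add_sum_rep {f d : Circ → ℝ} {Ξ : Finset Circ} {C : ℝ}
    (hsum : ∑ ξ ∈ Ξ, d ξ = 0)
    (h : ∀ x ∉ Ξ, f x = C + ∑ ξ ∈ Ξ, d ξ * rep (x - ξ)) : ∫ x, f x = C := by
  have h1 : ∫ x, f x = ∫ x, (C + ∑ ξ ∈ Ξ, d ξ * rep (x - ξ)) := by
    refine integral_congr_ae ?_
    filter_upwards [ae_notMem_finset Ξ] with x hx using h x hx
  rw [h1, integral_add (integrable_const _)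
    (integrable_finsetSum _ fun ξ _ => (integrable_rep_sub ξ).const_mul _),
    integral_finsetSum _ fun ξ _ => (integrable_rep_sub ξ).const_mul _]
  simp only [integral_const_mul, integral_rep_sub, ← Finset.sum_mul, hsum]
  simp [Measure.real]

open Classical in
/-- Moving by `h` to the right changes `f` by minus the sum of the jumps that are passed. -/
theorem sub_eq_neg_sum_crossing {f d : Circ → ℝ} {Ξ : Finset Circ} {C : ℝ}
    (hsum : ∑ ξ ∈ Ξ, d ξ = 0)
    (hf : ∀ x ∉ Ξ, f x = C + ∑ ξ ∈ Ξ, d ξ * rep (x - ξ)) {h : ℝ} (h0 : 0 ≤ h) (h1 : h < 1)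
    {x : Circ} (hx : x ∉ Ξ) (hxh : x + (h : Circ) ∉ Ξ) :
    f (x + (h : Circ)) - f x = -∑ ξ ∈ Ξ, if crossing h (x - ξ) then d ξ else 0 := by
  rw [hf x hx, hf _ hxh]
  have : ∑ ξ ∈ Ξ, d ξ * rep (x + (h : Circ) - ξ) =
      ∑ ξ ∈ Ξ, (d ξ * rep (x - ξ) + d ξ * h - if crossing h (x - ξ) then d ξ else 0) := by
    refine Finset.sum_congr rfl fun ξ _ => ?_
    rw [add_sub_right_comm, rep_add_coe h0 h1]
    split_ifs <;> ring
  rw [this, Finset.sum_sub_distrib, Finset.sum_add_distrib, ← Finset.sum_mul, hsum]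
  ring

/-! ### Integrality of the sums of jumps over clusters -/

/-- Continuity of translation in `L¹`. -/
theorem tendsto_lintegral_add_sub {ψ : Circ → ℂ} (hψ : Measurable ψ) (hψ1 : ∀ x, ‖ψ x‖ = 1) :
    Tendsto (fun a : Circ => ∫⁻ x, ‖ψ (x + a) - ψ x‖ₑ) (𝓝 0) (𝓝 0) := by
  have hm : MemLp ψ 1 (volume : Measure Circ) :=
    MemLp.of_bound hψ.aestronglyMeasurable 1 (ae_of_all _ fun x => (hψ1 x).le)
  have : Fact ((1 : ENNReal) ≠ ⊤) := ⟨ENNReal.one_ne_top⟩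
  have hcont : Continuous fun a : Circ => DomAddAct.mk a +ᵥ hm.toLp ψ :=
    (continuous_id.vadd continuous_const).comp DomAddAct.continuous_mk
  have h1 : Tendsto (fun a : Circ => edist (DomAddAct.mk a +ᵥ hm.toLp ψ) (hm.toLp ψ))
      (𝓝 0) (𝓝 0) := by
    have := (hcont.edist (continuous_const (y := hm.toLp ψ))).tendsto 0
    simpa using this
  refine h1.congr fun a => ?_
  rw [DomAddAct.mk_vadd_toLp, Lp.edist_toLp_toLp, eLpNorm_one_eq_lintegral_enorm]
  simp only [Pi.sub_apply, vadd_eq_add, add_comm]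

theorem ae_add_right {P : Circ → Prop} (h : ∀ᵐ x, P x) (a : Circ) : ∀ᵐ x, P (x + a) :=
  (measurePreserving_add_right (volume : Measure Circ) a).quasiMeasurePreserving.ae h

theorem ae_forall_add_zsmul {P : Circ → Prop} (h : ∀ᵐ x, P x) (a : Circ) :
    ∀ᵐ x, ∀ j : ℤ, P (x + j • a) :=
  ae_all_iff.2 fun j => ae_add_right h (j • a)

/-- If the translates of `I` by `j • a`, `j ∈ s`, are disjoint, then the integrals of `F` over
them add up to at most the integral of `F`. -/
theorem sum_setLIntegral_add_zsmul_le {F : Circ → ENNReal} (hF : Measurable F) {I : Set Circ}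
    (hI : MeasurableSet I) (a : Circ) (s : Finset ℤ)
    (hd : ∀ i ∈ s, ∀ j ∈ s, i ≠ j → ∀ x, x - i • a ∈ I → x - j • a ∉ I) :
    ∑ j ∈ s, ∫⁻ z in I, F (z + j • a) ≤ ∫⁻ x, F x := by
  have h1 : ∀ j : ℤ, ∫⁻ z in I, F (z + j • a) = ∫⁻ x in (fun x => x - j • a) ⁻¹' I, F x := by
    intro j
    rw [← (measurePreserving_add_right (volume : Measure Circ) (j • a)).setLIntegral_comp_preimage
      (hI.preimage (measurable_sub_const (j • a))) hF]
    congr 2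
    ext x; simp
  simp only [h1]
  rw [← lintegral_biUnion_finset]
  · exact setLIntegral_le_lintegral _ _
  · intro i hi j hj hij
    exact Set.disjoint_left.2 fun x hx => hd i hi j hj hij x hx
  · exact fun j _ => hI.preimage (measurable_sub_const (j • a))

open Classical in
/-- If `ψ` satisfies the cohomological equation for `exp (2πirf)`, then the quotient
`ψ (x + h) / ψ x` is multiplied along an orbit by a factor that depends only on the
discontinuities of `f` passed between `x` and `x + h`. -/
theorem ae_div_add_nsmul_eq {α r : ℝ} {f d : Circ → ℝ} {Ξ : Finset Circ} {C : ℝ}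
    (hsum : ∑ ξ ∈ Ξ, d ξ = 0)
    (hf : ∀ x ∉ Ξ, f x = C + ∑ ξ ∈ Ξ, d ξ * rep (x - ξ)) {ψ : Circ → ℂ}
    (hcob : ∀ᵐ x, ψ (x + (α : Circ)) = Complex.exp (2 * Real.pi * Complex.I * r * f x) * ψ x)
    {h : ℝ} (h0 : 0 ≤ h) (h1 : h < 1) :
    ∀ᵐ x : Circ, ∀ n : ℕ, ψ (x + n • (α : Circ) + (h : Circ)) / ψ (x + n • (α : Circ)) =
      Complex.exp (-(2 * Real.pi * Complex.I * (r * (∑ k ∈ Finset.range n, ∑ ξ ∈ Ξ,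
        if crossing h (x + k • (α : Circ) - ξ) then d ξ else 0 : ℝ)))) *
        (ψ (x + (h : Circ)) / ψ x) := by
  have hA : ∀ᵐ x : Circ, x ∉ Ξ ∧
      ψ (x + (α : Circ)) = Complex.exp (2 * Real.pi * Complex.I * r * f x) * ψ x := by
    filter_upwards [ae_notMem_finset Ξ, hcob] with x h1 h2 using ⟨h1, h2⟩
  filter_upwards [ae_forall_add_zsmul (hA.and (ae_add_right hA (h : Circ))) (α : Circ)] with x hx n
  induction n with
  | zero => simp
  | succ n ih =>
    have hn := hx n
    rw [natCast_zsmul] at hn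
    obtain ⟨⟨h2, h3⟩, h4, h5⟩ := hn
    have e1 : x + (n + 1) • (α : Circ) = x + n • (α : Circ) + (α : Circ) := by
      rw [succ_nsmul, add_assoc]
    have e2 : x + n • (α : Circ) + (α : Circ) + (h : Circ) =
      x + n • (α : Circ) + (h : Circ) + (α : Circ) := by abel
    have e3 := sub_eq_neg_sum_crossing hsum hf h0 h1 h2 h4
    rw [e1, e2, h3, h5, mul_div_mul_comm, ← Complex.exp_sub, ih, Finset.sum_range_succ, ← mul_assoc,
      ← Complex.exp_add]
    congr 2
    rw [← mul_sub, ← Complex.ofReal_sub, e3]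
    push_cast
    ring

open Classical in
/-- The discontinuities passed between the orbit segments of `z` and of `z + h`: if, at scale `N`,
the points of `K ⊆ Ξ` lie next to the segment of length `δ N` of the orbit of `ξ₀` and those of
`Ξ \ K` do not, then each point of `K` is passed exactly once and the others are not passed. -/
theorem sum_crossing_eq {α c δ : ℝ} (hα : ∀ m : ℤ, m ≠ 0 → c ≤ |(m : ℝ)| * ‖m • (α : Circ)‖)
    (hδ : 0 < δ) (hδc : 4 * δ ^ 2 < c) {N : ℕ} (hN : 0 < N)
    {Ξ K : Finset Circ} (hK : K ⊆ Ξ) {ξ₀ : Circ} {d : Circ → ℝ}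
    (hnear : ∀ ξ ∈ K, ∃ b : ℤ, |(b : ℝ)| ≤ δ / 8 * N ∧ N * ‖ξ - ξ₀ - b • (α : Circ)‖ ≤ δ / 8)
    (hfar : ∀ ξ ∈ Ξ, ξ ∉ K → ∀ b : ℤ, |(b : ℝ)| ≤ δ * N → δ < N * ‖ξ - ξ₀ - b • (α : Circ)‖)
    {J : ℕ} (hJ0 : δ / 8 * N < J) (hJ1 : J ≤ δ * N) {z : Circ}
    (hz : z ∈ Metric.closedBall (ξ₀ - ((δ / N / 2 : ℝ) : Circ)) (δ / N / 4)) :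
    (∑ k ∈ Finset.range (2 * J), ∑ ξ ∈ Ξ,
      if crossing (δ / N) (z - J • (α : Circ) + k • (α : Circ) - ξ) then d ξ else 0) =
    ∑ ξ ∈ K, d ξ := by
  have hNR : (0 : ℝ) < N := by exact_mod_cast hN
  set h := δ / N with hh
  have hh0 : 0 < h := by positivity
  have hNh : N * h = δ := by rw [hh]; field_simp
  obtain ⟨u, hu, hun⟩ := exists_coe_eq_abs_eq_norm (z - (ξ₀ - ((h / 2 : ℝ) : Circ)))
  rw [Metric.mem_closedBall, dist_eq_norm, ← hun] at hz
  -- `z = ξ₀ + s` with `s` in the middle half of `(-h, 0)`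
  obtain ⟨s, hs, hs1, hs2⟩ : ∃ s : ℝ, z = ξ₀ + (s : Circ) ∧ -(3 * h / 4) ≤ s ∧ s ≤ -(h / 4) := by
    refine ⟨u - h / 2, ?_, by linarith [(abs_le.1 hz).1], by linarith [(abs_le.1 hz).2]⟩
    rw [AddCircle.coe_sub, hu]; abel
  have hcross : ∀ (k : ℕ) (ξ : Circ), crossing h (z - J • (α : Circ) + k • (α : Circ) - ξ) →
      ‖ξ - ξ₀ - ((k : ℤ) - J) • (α : Circ)‖ ≤ h := by
    rintro k ξ ⟨t, ⟨ht1, ht2⟩, ht⟩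
    have : ξ - ξ₀ - ((k : ℤ) - J) • (α : Circ) = ((s - t : ℝ) : Circ) := by
      rw [AddCircle.coe_sub, ← ht, hs, sub_smul, natCast_zsmul, natCast_zsmul]; abel
    rw [this]
    refine (norm_coe_le_abs _).trans (abs_le.2 ⟨by linarith, by linarith⟩)
  have hkJ : ∀ k ∈ Finset.range (2 * J), |(((k : ℤ) - J : ℤ) : ℝ)| ≤ δ * N := by
    intro k hk
    rw [Finset.mem_range] at hk
    refine le_trans ?_ hJ1
    have : |(k : ℤ) - J| ≤ J := by rw [abs_le]; omega
    exact_mod_cast this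
  rw [Finset.sum_comm, ← Finset.sum_subset hK]
  · refine Finset.sum_congr rfl fun ξ hξ => ?_
    obtain ⟨b, hb1, hb2⟩ := hnear ξ hξ
    have hbJ : |b| < J := by
      have : |(b : ℝ)| < J := hb1.trans_lt hJ0
      exact_mod_cast this
    rw [abs_lt] at hbJ
    have hsmall : ‖ξ - ξ₀ - b • (α : Circ)‖ ≤ h / 8 := by
      rw [← hNh, mul_div_assoc] at hb2
      exact le_of_mul_le_mul_left hb2 hNR
    rw [Finset.sum_eq_single (b + J).toNat]
    · rw [if_pos]
      obtain ⟨w, hw, hwn⟩ := exists_coe_eq_abs_eq_norm (ξ - ξ₀ - b • (α : Circ))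
      rw [← hwn] at hsmall
      have := abs_le.1 hsmall
      refine ⟨s - w, ⟨by linarith, by linarith⟩, ?_⟩
      have e : (b + J).toNat • (α : Circ) = b • (α : Circ) + J • (α : Circ) := by
        rw [← natCast_zsmul, Int.toNat_of_nonneg (by omega), add_smul, natCast_zsmul]
      rw [AddCircle.coe_sub, hw, hs, e]; abel
    · intro k hk hkb
      rw [if_neg]
      intro hcr
      have h1 := hcross k ξ hcr
      have hne : (k : ℤ) - J - b ≠ 0 := by omega
      have h2 := hα _ hne
      have h3 : ‖((k : ℤ) - J - b) • (α : Circ)‖ ≤ 2 * h := by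
        have : ((k : ℤ) - J - b) • (α : Circ) =
            (ξ - ξ₀ - b • (α : Circ)) - (ξ - ξ₀ - ((k : ℤ) - J) • (α : Circ)) := by
          rw [sub_smul ((k : ℤ) - J)]; abel
        rw [this]
        refine (norm_sub_le _ _).trans (by linarith)
      have h4 : |(((k : ℤ) - J - b : ℤ) : ℝ)| ≤ 2 * δ * N := by
        rw [Int.cast_sub]
        refine (abs_sub _ _).trans ?_
        have := hkJ k hk
        nlinarith
      have : c ≤ (2 * δ * N) * (2 * h) := h2.trans (by gcongr)
      have e : (2 * δ * N) * (2 * h) = 4 * δ ^ 2 := by rw [← hNh]; ring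
      linarith
    · intro hk
      rw [Finset.mem_range] at hk
      omega
  · intro ξ hξ hξK
    refine Finset.sum_eq_zero fun k hk => if_neg fun hcr => ?_
    have h1 := hfar ξ hξ hξK _ (hkJ k hk)
    have h2 := mul_le_mul_of_nonneg_left (hcross k ξ hcr) hNR.le
    rw [hNh] at h2
    linarith

/-- The averaging step: the factor `exp (-2πir ∑_K d)` by which `ψ (x + δ/N) / ψ x` jumps across
the cluster `K` is as close to `1` as the translation by `δ/N` moves `ψ` little in `L¹`. -/
theorem ofReal_mul_enorm_exp_sub_one_le {α c δ r C : ℝ}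
    (hα : ∀ m : ℤ, m ≠ 0 → c ≤ |(m : ℝ)| * ‖m • (α : Circ)‖)
    (hδ : 0 < δ) (hδc : 4 * δ ^ 2 < c) {N : ℕ} (hN : 8 ≤ δ * N) (hN' : δ < N)
    {Ξ K : Finset Circ} (hK : K ⊆ Ξ) {ξ₀ : Circ} {f d : Circ → ℝ}
    (hsum : ∑ ξ ∈ Ξ, d ξ = 0)
    (hf : ∀ x ∉ Ξ, f x = C + ∑ ξ ∈ Ξ, d ξ * rep (x - ξ)) {ψ : Circ → ℂ}
    (hψ : Measurable ψ) (hψ1 : ∀ x, ‖ψ x‖ = 1)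
    (hcob : ∀ᵐ x, ψ (x + (α : Circ)) = Complex.exp (2 * Real.pi * Complex.I * r * f x) * ψ x)
    (hnear : ∀ ξ ∈ K, ∃ b : ℤ, |(b : ℝ)| ≤ δ / 8 * N ∧ N * ‖ξ - ξ₀ - b • (α : Circ)‖ ≤ δ / 8)
    (hfar : ∀ ξ ∈ Ξ, ξ ∉ K → ∀ b : ℤ, |(b : ℝ)| ≤ δ * N → δ < N * ‖ξ - ξ₀ - b • (α : Circ)‖) :
    ENNReal.ofReal (δ ^ 2 / 4) *
      ‖Complex.exp (-(2 * Real.pi * Complex.I * (r * (∑ ξ ∈ K, d ξ : ℝ)))) - 1‖ₑ ≤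
      2 * ∫⁻ x, ‖ψ (x + ((δ / N : ℝ) : Circ)) - ψ x‖ₑ := by
  classical
  have hNR : (0 : ℝ) < N := hδ.trans hN'
  have hN0 : 0 < N := by exact_mod_cast hNR
  set h := δ / N with hh
  have hh0 : 0 < h := by positivity
  have hh1 : h < 1 := by rw [hh, div_lt_one hNR]; exact hN'
  have hNh : N * h = δ := by rw [hh]; field_simp
  set θ := Complex.exp (-(2 * Real.pi * Complex.I * (r * (∑ ξ ∈ K, d ξ : ℝ)))) with hθ
  have hθ1 : ‖θ‖ = 1 := by
    have : θ = Complex.exp ((-(2 * Real.pi * (r * ∑ ξ ∈ K, d ξ)) : ℝ) * Complex.I) := by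
      rw [hθ]; congr 1; push_cast; ring
    rw [this, Complex.norm_exp_ofReal_mul_I]
  set F : Circ → ENNReal := fun x => ‖ψ (x + (h : Circ)) - ψ x‖ₑ with hF
  have hFm : Measurable F := ((hψ.comp (measurable_add_const _)).sub hψ).enorm
  have hψ0 : ∀ x, ψ x ≠ 0 := fun x hx => by simpa [hx] using hψ1 x
  have hFρ : ∀ x, F x = ‖ψ (x + (h : Circ)) / ψ x - 1‖ₑ := by
    intro x
    simp only [hF, enorm_eq_iff_norm_eq]
    rw [div_sub_one (hψ0 x), norm_div, hψ1, div_one]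
  set I := Metric.closedBall (ξ₀ - ((h / 2 : ℝ) : Circ)) (h / 4) with hI
  have hIm : MeasurableSet I := Metric.isClosed_closedBall.measurableSet
  have hIv : volume I = ENNReal.ofReal (h / 2) := by
    rw [hI, AddCircle.volume_closedBall, min_eq_right (by linarith)]
    congr 1; ring
  -- the half lengths `J` of the orbit segments over which the average is taken
  set s : Finset ℕ := Finset.Ioc ⌊δ / 8 * N⌋₊ ⌊δ * N⌋₊ with hs
  have hsJ : ∀ J ∈ s, δ / 8 * N < J ∧ J ≤ δ * N := by
    intro J hJ
    rw [hs, Finset.mem_Ioc] at hJ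
    exact ⟨(Nat.floor_lt (by positivity)).1 hJ.1, (Nat.le_floor_iff (by positivity)).1 hJ.2⟩
  -- pointwise comparison on the two sides of the cluster
  have hpt : ∀ J ∈ s, ∀ᵐ z, z ∈ I →
      ‖θ - 1‖ₑ ≤ F (z + (J : ℤ) • (α : Circ)) + F (z + (-(J : ℤ)) • (α : Circ)) := by
    intro J hJ
    filter_upwards [ae_add_right (ae_div_add_nsmul_eq hsum hf hcob hh0.le hh1)
      ((-(J : ℤ)) • (α : Circ))] with z hz hzI
    have h1 := hz (2 * J)
    have e0 : z + (-(J : ℤ)) • (α : Circ) = z - J • (α : Circ) := by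
      rw [neg_smul, natCast_zsmul, sub_eq_add_neg]
    have e1 : z - J • (α : Circ) + (2 * J) • (α : Circ) = z + (J : ℤ) • (α : Circ) := by
      rw [two_mul, add_smul, natCast_zsmul]; abel
    rw [e0, sum_crossing_eq hα hδ hδc hN0 hK hnear hfar (hsJ J hJ).1 (hsJ J hJ).2 hzI, e1,
      ← hθ] at h1
    rw [hFρ, hFρ, h1, e0]
    set ρ := ψ (z - J • (α : Circ) + (h : Circ)) / ψ (z - J • (α : Circ)) with hρ
    calc ‖θ - 1‖ₑ = ‖(θ * ρ - 1) - θ * (ρ - 1)‖ₑ := by congr 1; ring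
      _ ≤ ‖θ * ρ - 1‖ₑ + ‖θ * (ρ - 1)‖ₑ := enorm_sub_le
      _ = _ := by
        rw [enorm_mul]
        have : ‖θ‖ₑ = 1 := by rw [← ofReal_norm, hθ1, ENNReal.ofReal_one]
        rw [this, one_mul]
  have hint : ∀ J ∈ s, ‖θ - 1‖ₑ * ENNReal.ofReal (h / 2) ≤
      (∫⁻ z in I, F (z + (J : ℤ) • (α : Circ))) +
        ∫⁻ z in I, F (z + (-(J : ℤ)) • (α : Circ)) := by
    intro J hJ
    have hm : Measurable fun z => F (z + (J : ℤ) • (α : Circ)) :=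
      hFm.comp (measurable_add_const _)
    rw [← hIv, ← setLIntegral_const, ← lintegral_add_left hm]
    exact setLIntegral_mono_ae' hIm (hpt J hJ)
  -- the translates of `I` by different multiples of `α` are disjoint
  have hdisj : ∀ i j : ℤ, |(i : ℝ)| ≤ δ * N → |(j : ℝ)| ≤ δ * N → i ≠ j →
      ∀ x, x - i • (α : Circ) ∈ I → x - j • (α : Circ) ∉ I := by
    intro i j hi hj hij x hxi hxj
    have h1 := hα (i - j) (sub_ne_zero.2 hij)
    have h2 : ‖(i - j) • (α : Circ)‖ ≤ h / 4 + h / 4 := by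
      have := dist_triangle_right (x - j • (α : Circ)) (x - i • (α : Circ))
        (ξ₀ - ((h / 2 : ℝ) : Circ))
      rw [dist_eq_norm] at this
      have e : x - j • (α : Circ) - (x - i • (α : Circ)) = (i - j) • (α : Circ) := by
        rw [sub_smul]; abel
      rw [e] at this
      exact this.trans (add_le_add hxj hxi)
    have h3 : |((i - j : ℤ) : ℝ)| ≤ 2 * δ * N := by
      rw [Int.cast_sub]
      exact (abs_sub _ _).trans (by linarith)
    have : c ≤ (2 * δ * N) * (h / 4 + h / 4) := h1.trans (by gcongr)
    have e : (2 * δ * N) * (h / 4 + h / 4) = δ ^ 2 := by rw [← hNh]; ring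
    nlinarith
  have hsumle : ∀ σ : ℕ → ℤ, Function.Injective σ → (∀ J, |(σ J : ℝ)| = J) →
      ∑ J ∈ s, ∫⁻ z in I, F (z + (σ J) • (α : Circ)) ≤ ∫⁻ x, F x := by
    intro σ hσ hσJ
    have := sum_setLIntegral_add_zsmul_le hFm hIm (α : Circ) (s.map ⟨σ, hσ⟩) ?_
    · simpa [Finset.sum_map] using this
    · intro i hi j hj hij
      rw [Finset.mem_map] at hi hj
      obtain ⟨i, hi, rfl⟩ := hi
      obtain ⟨j, hj, rfl⟩ := hj
      exact hdisj _ _ ((hσJ i).trans_le (hsJ i hi).2) ((hσJ j).trans_le (hsJ j hj).2) hij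
  have hp := hsumle (fun J => (J : ℤ)) (fun a b => by simp) (fun J => by simp)
  have hm := hsumle (fun J => -(J : ℤ)) (fun a b => by simp) (fun J => by simp)
  have hcard : δ * N / 2 ≤ s.card := by
    rw [hs, Nat.card_Ioc]
    have h1 := Nat.lt_floor_add_one (δ * N)
    have h2 := Nat.floor_le (by positivity : 0 ≤ δ / 8 * N)
    have h3 : (⌊δ * N⌋₊ : ℝ) ≤ (⌊δ * N⌋₊ - ⌊δ / 8 * N⌋₊ : ℕ) + ⌊δ / 8 * N⌋₊ := by
      exact_mod_cast le_tsub_add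
    linarith
  calc ENNReal.ofReal (δ ^ 2 / 4) * ‖θ - 1‖ₑ
      ≤ (s.card * ENNReal.ofReal (h / 2)) * ‖θ - 1‖ₑ := by
        gcongr
        rw [← ENNReal.ofReal_natCast, ← ENNReal.ofReal_mul (by positivity)]
        refine ENNReal.ofReal_le_ofReal ?_
        calc δ ^ 2 / 4 = δ * N / 2 * (h / 2) := by rw [← hNh]; ring
          _ ≤ _ := by gcongr
    _ = ∑ J ∈ s, ‖θ - 1‖ₑ * ENNReal.ofReal (h / 2) := by
        rw [Finset.sum_const, nsmul_eq_mul]; ring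
    _ ≤ ∑ J ∈ s, ((∫⁻ z in I, F (z + (J : ℤ) • (α : Circ))) +
        ∫⁻ z in I, F (z + (-(J : ℤ)) • (α : Circ))) := Finset.sum_le_sum hint
    _ ≤ (∫⁻ x, F x) + ∫⁻ x, F x := by
        rw [Finset.sum_add_distrib]; exact add_le_add hp hm
    _ = _ := (two_mul _).symm

/-- Along the ultrafilter `𝒰`, the point `ξ` lies within `o(1/N)` of the segment of length `o(N)`
of the orbit of `ξ'` under the rotation by `α`. -/
def Near (α : ℝ) (𝒰 : Ultrafilter ℕ) (ξ ξ' : Circ) : Prop :=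
  ∀ δ : ℝ, 0 < δ → ∀ᶠ N : ℕ in 𝒰, ∃ b : ℤ, |(b : ℝ)| ≤ δ * N ∧ N * ‖ξ - ξ' - b • (α : Circ)‖ ≤ δ

open Classical in
/-- The jumps in a cluster add up to an integer: otherwise `ψ` would oscillate by a fixed amount
at all small scales, on a set whose measure is bounded below. -/
theorem exists_int_eq_mul_sum_near {α c r C : ℝ} (hc : 0 < c)
    (hα : ∀ m : ℤ, m ≠ 0 → c ≤ |(m : ℝ)| * ‖m • (α : Circ)‖)
    {Ξ : Finset Circ} {f d : Circ → ℝ} (hsum : ∑ ξ ∈ Ξ, d ξ = 0)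
    (hf : ∀ x ∉ Ξ, f x = C + ∑ ξ ∈ Ξ, d ξ * rep (x - ξ)) {ψ : Circ → ℂ}
    (hψ : Measurable ψ) (hψ1 : ∀ x, ‖ψ x‖ = 1)
    (hcob : ∀ᵐ x, ψ (x + (α : Circ)) = Complex.exp (2 * Real.pi * Complex.I * r * f x) * ψ x)
    (𝒰 : Ultrafilter ℕ) (h𝒰 : (𝒰 : Filter ℕ) ≤ atTop) (ξ₀ : Circ) :
    ∃ k : ℤ, r * ∑ ξ ∈ Ξ with Near α 𝒰 ξ ξ₀, d ξ = k := by
  set K := Ξ.filter fun ξ => Near α 𝒰 ξ ξ₀ with hK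
  have hfar : ∀ ξ ∈ Ξ, ∀ᶠ δ : ℝ in 𝓝[>] 0, ξ ∉ K → ∀ᶠ N : ℕ in 𝒰,
      ∀ b : ℤ, |(b : ℝ)| ≤ δ * N → δ < N * ‖ξ - ξ₀ - b • (α : Circ)‖ := by
    intro ξ hξ
    by_cases hn : Near α 𝒰 ξ ξ₀
    · exact Eventually.of_forall fun δ h => absurd (Finset.mem_filter.2 ⟨hξ, hn⟩) h
    · simp only [Near, not_forall, exists_prop] at hn
      obtain ⟨δ, hδ, hn⟩ := hn
      rw [← Ultrafilter.eventually_not] at hn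
      filter_upwards [Ioo_mem_nhdsGT hδ] with δ' hδ' _
      filter_upwards [hn] with N hN b hb
      push Not at hN
      exact hδ'.2.trans (hN b (hb.trans (by gcongr; exact hδ'.2.le)))
  have hsmall : ∀ᶠ δ : ℝ in 𝓝[>] 0, 4 * δ ^ 2 < c := by
    have : Tendsto (fun δ : ℝ => 4 * δ ^ 2) (𝓝 0) (𝓝 (4 * 0 ^ 2)) :=
      (continuous_const.mul (continuous_pow 2)).tendsto 0
    exact nhdsWithin_le_nhds (this.eventually_lt_const (by simpa using hc))
  obtain ⟨δ, ⟨hδf, hδc⟩, hδ⟩ := (((eventually_all_finset Ξ).2 hfar).and hsmall |>.and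
    self_mem_nhdsWithin).exists
  replace hδ : 0 < δ := hδ
  set θ := Complex.exp (-(2 * Real.pi * Complex.I * (r * (∑ ξ ∈ K, d ξ : ℝ)))) with hθ
  have hev : ∀ᶠ N : ℕ in 𝒰, ENNReal.ofReal (δ ^ 2 / 4) * ‖θ - 1‖ₑ ≤
      2 * ∫⁻ x, ‖ψ (x + ((δ / N : ℝ) : Circ)) - ψ x‖ₑ := by
    have h1 : ∀ᶠ N : ℕ in 𝒰, ∀ ξ ∈ K, ∃ b : ℤ, |(b : ℝ)| ≤ δ / 8 * N ∧
        N * ‖ξ - ξ₀ - b • (α : Circ)‖ ≤ δ / 8 :=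
      (eventually_all_finset K).2 fun ξ hξ => (Finset.mem_filter.1 hξ).2 _ (by positivity)
    have h2 : ∀ᶠ N : ℕ in 𝒰, ∀ ξ ∈ Ξ, ξ ∉ K → ∀ b : ℤ, |(b : ℝ)| ≤ δ * N →
        δ < N * ‖ξ - ξ₀ - b • (α : Circ)‖ := by
      refine (eventually_all_finset Ξ).2 fun ξ hξ => ?_
      by_cases hk : ξ ∈ K
      · exact Eventually.of_forall fun N h => absurd hk h
      · exact (hδf ξ hξ hk).mono fun N hN _ => hN
    have h3 : ∀ᶠ N : ℕ in 𝒰, 8 ≤ δ * N :=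
      h𝒰 ((tendsto_natCast_atTop_atTop.const_mul_atTop hδ).eventually_ge_atTop 8)
    have h4 : ∀ᶠ N : ℕ in 𝒰, δ < N :=
      h𝒰 ((tendsto_natCast_atTop_atTop (R := ℝ)).eventually_gt_atTop δ)
    filter_upwards [h1, h2, h3, h4] with N h1 h2 h3 h4
    exact ofReal_mul_enorm_exp_sub_one_le hα hδ hδc h3 h4 (Finset.filter_subset _ _) hsum hf hψ hψ1
      hcob h1 h2
  have hlim : Tendsto (fun N : ℕ => 2 * ∫⁻ x, ‖ψ (x + ((δ / N : ℝ) : Circ)) - ψ x‖ₑ) 𝒰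
      (𝓝 (2 * 0)) := by
    refine ENNReal.Tendsto.const_mul ?_ (Or.inr (by simp))
    have h1 : Tendsto (fun N : ℕ => ((δ / N : ℝ) : Circ)) atTop (𝓝 0) := by
      have := (tendsto_add_coe 0).comp (tendsto_const_div_atTop_nhds_zero_nat δ)
      simpa [Function.comp_def] using this
    exact (tendsto_lintegral_add_sub hψ hψ1).comp (h1.mono_left h𝒰)
  have hle := ge_of_tendsto hlim hev
  rw [mul_zero, nonpos_iff_eq_zero, mul_eq_zero, ENNReal.ofReal_eq_zero, enorm_eq_zero] at hle
  rcases hle with hle | hle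
  · have : 0 < δ ^ 2 / 4 := by positivity
    linarith
  · rw [sub_eq_zero, hθ, Complex.exp_eq_one_iff] at hle
    obtain ⟨n, hn⟩ := hle
    refine ⟨-n, ?_⟩
    have hpi : (2 * Real.pi * Complex.I : ℂ) ≠ 0 := Complex.two_pi_I_ne_zero
    have h1 : ((r * ∑ ξ ∈ K, d ξ : ℝ) : ℂ) = ((-n : ℤ) : ℂ) := by
      refine mul_left_cancel₀ hpi ?_
      push_cast at hn ⊢
      linear_combination -hn
    exact_mod_cast h1

/-! ### Clusters do not depend on the scale -/

theorem Near.refl (α : ℝ) (𝒰 : Ultrafilter ℕ) (ξ : Circ) : Near α 𝒰 ξ ξ := fun δ hδ =>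
  Eventually.of_forall fun N => ⟨0, by simp; positivity, by simp; positivity⟩

theorem Near.symm {α : ℝ} {𝒰 : Ultrafilter ℕ} {ξ ξ' : Circ} (h : Near α 𝒰 ξ ξ') :
    Near α 𝒰 ξ' ξ := fun δ hδ => (h δ hδ).mono fun N ⟨b, hb1, hb2⟩ => by
  refine ⟨-b, by simpa using hb1, ?_⟩
  have e : ξ' - ξ - (-b) • (α : Circ) = -(ξ - ξ' - b • (α : Circ)) := by rw [neg_smul]; abel
  rwa [e, norm_neg]

theorem Near.trans {α : ℝ} {𝒰 : Ultrafilter ℕ} {ξ ξ' ξ'' : Circ} (h : Near α 𝒰 ξ ξ')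
    (h' : Near α 𝒰 ξ' ξ'') : Near α 𝒰 ξ ξ'' := fun δ hδ => by
  filter_upwards [h (δ / 2) (by positivity), h' (δ / 2) (by positivity)]
    with N ⟨b, hb1, hb2⟩ ⟨b', hb1', hb2'⟩
  refine ⟨b + b', ?_, ?_⟩
  · push_cast
    exact (abs_add_le _ _).trans (by linarith)
  · have e : ξ - ξ'' - (b + b') • (α : Circ) =
        (ξ - ξ' - b • (α : Circ)) + (ξ' - ξ'' - b' • (α : Circ)) := by rw [add_smul]; abel
    rw [e]
    have := mul_le_mul_of_nonneg_left (norm_add_le (ξ - ξ' - b • (α : Circ))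
      (ξ' - ξ'' - b' • (α : Circ))) (Nat.cast_nonneg N : (0 : ℝ) ≤ N)
    linarith

/-- A partition of the points of `Ξ` into clusters at scale `N`: the difference of two points in a
common class is within `ε / N` of a multiple `b α` with `|b| ≤ ε N`, and `r` times the sum of the
weights in each class is an integer. -/
def IsIntegralClustering (α r ε : ℝ) (Ξ : Finset Circ) (d : Circ → ℝ) (N : ℕ) (s : Setoid Circ) :
    Prop :=
  open Classical in
  (∀ ξ ∈ Ξ, ∀ ξ' ∈ Ξ, s ξ ξ' → ∃ b : ℤ, |(b : ℝ)| ≤ ε * N ∧ N * ‖ξ - ξ' - b • (α : Circ)‖ ≤ ε) ∧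
    ∀ ξ₀ ∈ Ξ, ∃ k : ℤ, r * ∑ ξ ∈ Ξ with s ξ ξ₀, d ξ = k

/-- If the clusters along every ultrafilter of scales have integral sums, then so does a partition
into `ε`-clusters at each large scale: otherwise, take an ultrafilter of scales without such a
partition, and divide `Ξ` into its clusters. -/
theorem eventually_exists_isIntegralClustering {α r ε : ℝ} (hε : 0 < ε) {Ξ : Finset Circ}
    {d : Circ → ℝ}
    (h : open Classical in ∀ 𝒰 : Ultrafilter ℕ, (𝒰 : Filter ℕ) ≤ atTop → ∀ ξ₀ : Circ,
      ∃ k : ℤ, r * ∑ ξ ∈ Ξ with Near α 𝒰 ξ ξ₀, d ξ = k) :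
    ∀ᶠ N in atTop, ∃ s, IsIntegralClustering α r ε Ξ d N s := by
  refine mem_iff_ultrafilter.2 fun 𝒰 h𝒰 => ?_
  have h1 : ∀ᶠ N : ℕ in 𝒰, ∀ ξ ∈ Ξ, ∀ ξ' ∈ Ξ, Near α 𝒰 ξ ξ' →
      ∃ b : ℤ, |(b : ℝ)| ≤ ε * N ∧ N * ‖ξ - ξ' - b • (α : Circ)‖ ≤ ε := by
    refine (eventually_all_finset Ξ).2 fun ξ _ => (eventually_all_finset Ξ).2 fun ξ' _ => ?_
    by_cases hn : Near α 𝒰 ξ ξ'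
    · exact (hn ε hε).mono fun N hN _ => hN
    · exact Eventually.of_forall fun N h => absurd h hn
  filter_upwards [h1] with N hN
  exact ⟨⟨Near α 𝒰, Near.refl α 𝒰, Near.symm, Near.trans⟩, hN, fun ξ₀ _ => h 𝒰 h𝒰 ξ₀⟩

/-- `d` satisfies the combinatorial property (P1): each integer relation between the weights
involves two points whose difference lies in `(ℚ + ℚα) \ (ℤ + ℤα)`. -/
def RelationsSplit (α : ℝ) (Ξ : Finset Circ) (d : Circ → ℝ) : Prop :=
  ∀ n : Circ → ℤ, (∃ ξ ∈ Ξ, n ξ ≠ 0) → ∑ ξ ∈ Ξ, (n ξ : ℝ) * d ξ = 0 →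
    ∃ ξ ∈ Ξ, ∃ ξ' ∈ Ξ, ξ ≠ ξ' ∧ n ξ ≠ 0 ∧ n ξ' ≠ 0 ∧ ξ - ξ' ∈ ratSpan α \ intSpan α

open Classical in
/-- A subset of `Ξ` without rationally related pairs carries no integer relation between the
weights; so its integral subsets have nonzero sum, and two of them cannot differ. -/
theorem RelationsSplit.eq_of_integral {α r : ℝ} (hr : r ≠ 0) {Ξ : Finset Circ} {d : Circ → ℝ}
    (h : RelationsSplit α Ξ d) {A B : Finset Circ} (hA : A ⊆ Ξ) (hB : B ⊆ Ξ)
    (hA0 : A.Nonempty) (hB0 : B.Nonempty)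
    (hAB : ∀ ξ ∈ A ∪ B, ∀ ξ' ∈ A ∪ B, ξ - ξ' ∉ ratSpan α \ intSpan α) {k l : ℤ}
    (hk : r * ∑ ξ ∈ A, d ξ = k) (hl : r * ∑ ξ ∈ B, d ξ = l) : k ≠ 0 ∧ A = B := by
  have key : ∀ n : Circ → ℤ, (∀ ξ ∈ Ξ, ξ ∉ A ∪ B → n ξ = 0) →
      ∑ ξ ∈ Ξ, (n ξ : ℝ) * d ξ = 0 → ∀ ξ ∈ Ξ, n ξ = 0 := by
    intro n hn hs ξ hξ
    by_contra hne
    obtain ⟨a, ha, b, hb, -, hna, hnb, hab⟩ := h n ⟨ξ, hξ, hne⟩ hs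
    have ha' : a ∈ A ∪ B := by by_contra h'; exact hna (hn a ha h')
    have hb' : b ∈ A ∪ B := by by_contra h'; exact hnb (hn b hb h')
    exact hAB a ha' b hb' hab
  have hind : ∀ D : Finset Circ, D ⊆ Ξ → ∑ ξ ∈ Ξ, (if ξ ∈ D then d ξ else 0) = ∑ ξ ∈ D, d ξ := by
    intro D hD
    rw [← Finset.sum_filter, Finset.filter_mem_eq_inter, Finset.inter_eq_right.2 hD]
  have hnz : ∀ D : Finset Circ, D ⊆ Ξ → D ⊆ A ∪ B → D.Nonempty → ∀ m : ℤ,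
      r * ∑ ξ ∈ D, d ξ = m → m ≠ 0 := by
    rintro D hD hDAB ⟨ξ, hξ⟩ m hm rfl
    have hs : ∑ ξ ∈ D, d ξ = 0 := by
      simpa [hr] using hm
    have := key (fun ξ => if ξ ∈ D then 1 else 0)
      (fun ξ _ hξ => if_neg fun h' => hξ (hDAB h')) (by
        simp only [Int.cast_ite, Int.cast_one, Int.cast_zero, ite_mul, one_mul, zero_mul]
        rw [hind D hD, hs]) ξ (hD hξ)
    simp [hξ] at this
  have hk0 := hnz A hA Finset.subset_union_left hA0 k hk
  have hl0 := hnz B hB Finset.subset_union_right hB0 l hl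
  refine ⟨hk0, ?_⟩
  have hall := key (fun ξ => l * (if ξ ∈ A then 1 else 0) - k * (if ξ ∈ B then 1 else 0))
    (fun ξ _ hξ => by
      rw [Finset.mem_union, not_or] at hξ
      simp [hξ.1, hξ.2]) (by
    have e : ∀ ξ, (((l * (if ξ ∈ A then 1 else 0) - k * (if ξ ∈ B then 1 else 0) : ℤ)) : ℝ) * d ξ =
        l * (if ξ ∈ A then d ξ else 0) - k * (if ξ ∈ B then d ξ else 0) := by
      intro ξ
      push_cast
      split_ifs <;> ring
    simp only [e]
    rw [Finset.sum_sub_distrib, ← Finset.mul_sum, ← Finset.mul_sum, hind A hA, hind B hB, ← hk,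
      ← hl]
    ring)
  ext ξ
  constructor
  · intro hξ
    by_contra hξB
    have := hall ξ (hA hξ)
    simp [hξ, hξB, hl0] at this
  · intro hξ
    by_contra hξA
    have := hall ξ (hB hξ)
    simp [hξ, hξA, hk0] at this

open Classical in
/-- The clusters do not depend on the scale: those at the consecutive scales `N` and `N + 1` agree,
since their unions contain no rationally related pair. Hence points in the same cluster differ
exactly by a multiple of `α`. -/
theorem exists_setoid_sub_mem_zmultiples {α c r : ℝ} (hr : r ≠ 0) (hc : 0 < c)
    (hα : ∀ m : ℤ, m ≠ 0 → c ≤ |(m : ℝ)| * ‖m • (α : Circ)‖)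
    {Ξ : Finset Circ} {d : Circ → ℝ} (hd : RelationsSplit α Ξ d)
    (hcl : ∀ ε : ℝ, 0 < ε → ∀ᶠ N in atTop, ∃ s, IsIntegralClustering α r ε Ξ d N s) :
    ∃ s : Setoid Circ, (∀ ξ ∈ Ξ, ∀ ξ' ∈ Ξ, s ξ ξ' → ∃ b : ℤ, ξ - ξ' = b • (α : Circ)) ∧
      ∀ ξ₀ ∈ Ξ, ∃ k : ℤ, k ≠ 0 ∧ r * ∑ ξ ∈ Ξ with s ξ ξ₀, d ξ = k := by
  have hκ : ∀ᶠ κ : ℝ in 𝓝[>] 0, ∀ ξ ∈ Ξ, ∀ ξ' ∈ Ξ, ξ - ξ' ∈ ratSpan α \ intSpan α →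
      ∀ N : ℕ, 1 ≤ N → ∀ b : ℤ, |(b : ℝ)| ≤ N → 8 * κ < N * ‖ξ - ξ' - b • (α : Circ)‖ := by
    refine (eventually_all_finset Ξ).2 fun ξ _ => (eventually_all_finset Ξ).2 fun ξ' _ => ?_
    by_cases h : ξ - ξ' ∈ ratSpan α \ intSpan α
    · obtain ⟨κ, hκ, hb⟩ := exists_le_mul_norm_sub_zsmul hc hα h
      filter_upwards [Ioo_mem_nhdsGT (show 0 < κ / 8 by positivity)] with κ' hκ' _ N hN b hbN
      have := hb N hN b hbN
      linarith [hκ'.2]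
    · exact Eventually.of_forall fun κ h' => absurd h' h
  have hsmall : ∀ᶠ ε : ℝ in 𝓝[>] 0, 6 * ε ^ 2 < c := by
    have : Tendsto (fun δ : ℝ => 6 * δ ^ 2) (𝓝 0) (𝓝 (6 * 0 ^ 2)) :=
      (continuous_const.mul (continuous_pow 2)).tendsto 0
    exact nhdsWithin_le_nhds (this.eventually_lt_const (by simpa using hc))
  obtain ⟨ε, ⟨hεκ, hεc⟩, hε0, hε1⟩ := ((hκ.and hsmall).and
    (Ioo_mem_nhdsGT (show (0 : ℝ) < 1 / 8 by norm_num))).exists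
  obtain ⟨N₀, hN₀⟩ := eventually_atTop.1 ((hcl ε hε0).and (eventually_ge_atTop 1))
  choose s hs using fun N (hN : N₀ ≤ N) => (hN₀ N hN).1
  have hpos : ∀ N, N₀ ≤ N → 1 ≤ N := fun N hN => (hN₀ N hN).2
  have step : ∀ N (hN : N₀ ≤ N), ∀ i ∈ Ξ, (∃ k : ℤ, k ≠ 0 ∧ r * ∑ ξ ∈ Ξ with s N hN ξ i, d ξ = k) ∧
      (Ξ.filter fun ξ => s N hN ξ i) = Ξ.filter fun ξ => s (N + 1) (hN.trans N.le_succ) ξ i := by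
    intro N hN i hi
    have hNR : (1 : ℝ) ≤ N := by exact_mod_cast hpos N hN
    set A := Ξ.filter fun ξ => s N hN ξ i with hA
    set B := Ξ.filter fun ξ => s (N + 1) (hN.trans N.le_succ) ξ i with hB
    obtain ⟨hs1, hs2⟩ := hs N hN
    obtain ⟨hs1', hs2'⟩ := hs (N + 1) (hN.trans N.le_succ)
    obtain ⟨k, hk⟩ := hs2 i hi
    obtain ⟨l, hl⟩ := hs2' i hi
    have hclose : ∀ a ∈ A ∪ B, a ∈ Ξ ∧ ∃ b : ℤ, |(b : ℝ)| ≤ 2 * ε * N ∧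
        N * ‖a - i - b • (α : Circ)‖ ≤ ε := by
      intro a ha
      rcases Finset.mem_union.1 ha with h | h
      · rw [hA, Finset.mem_filter] at h
        obtain ⟨b, hb1, hb2⟩ := hs1 a h.1 i hi h.2
        exact ⟨h.1, b, hb1.trans (by nlinarith), hb2⟩
      · rw [hB, Finset.mem_filter] at h
        obtain ⟨b, hb1, hb2⟩ := hs1' a h.1 i hi h.2
        push_cast at hb1 hb2
        refine ⟨h.1, b, hb1.trans (by nlinarith), ?_⟩
        nlinarith [norm_nonneg (a - i - b • (α : Circ))]
    have hsep : ∀ ξ ∈ A ∪ B, ∀ ξ' ∈ A ∪ B, ξ - ξ' ∉ ratSpan α \ intSpan α := by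
      intro a ha a' ha' hbad
      obtain ⟨haΞ, b, hb1, hb2⟩ := hclose a ha
      obtain ⟨haΞ', b', hb1', hb2'⟩ := hclose a' ha'
      have h1 := hεκ a haΞ a' haΞ' hbad N (hpos N hN) (b - b') (by
        push_cast
        refine (abs_sub _ _).trans ?_
        nlinarith)
      have e : a - a' - (b - b') • (α : Circ) =
          (a - i - b • (α : Circ)) - (a' - i - b' • (α : Circ)) := by rw [sub_smul]; abel
      rw [e] at h1
      have h2 := mul_le_mul_of_nonneg_left (norm_sub_le (a - i - b • (α : Circ))
        (a' - i - b' • (α : Circ))) (Nat.cast_nonneg N : (0 : ℝ) ≤ N)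
      linarith
    have hiA : i ∈ A := Finset.mem_filter.2 ⟨hi, (s N hN).refl' i⟩
    have hiB : i ∈ B := Finset.mem_filter.2 ⟨hi, (s (N + 1) (hN.trans N.le_succ)).refl' i⟩
    obtain ⟨hk0, hAB⟩ := hd.eq_of_integral hr (Finset.filter_subset _ _) (Finset.filter_subset _ _)
      ⟨i, hiA⟩ ⟨i, hiB⟩ hsep hk hl
    exact ⟨⟨k, hk0, hk⟩, hAB⟩
  have hconst : ∀ N (hN : N₀ ≤ N), ∀ ξ ∈ Ξ, ∀ ξ' ∈ Ξ, s N₀ le_rfl ξ ξ' → s N hN ξ ξ' := by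
    intro N hN
    induction N, hN using Nat.le_induction with
    | base => exact fun _ _ _ _ h => h
    | succ N hN ih =>
      intro ξ hξ ξ' hξ' h
      have h1 : ξ ∈ Ξ.filter fun ξ => s N hN ξ ξ' := Finset.mem_filter.2 ⟨hξ, ih ξ hξ ξ' hξ' h⟩
      rw [(step N hN ξ' hξ').2] at h1
      exact (Finset.mem_filter.1 h1).2
  refine ⟨s N₀ le_rfl, fun ξ hξ ξ' hξ' hrel => ?_, fun ξ₀ hξ₀ => (step N₀ le_rfl ξ₀ hξ₀).1⟩
  choose b hb1 hb2 using fun N (hN : N₀ ≤ N) =>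
    (hs N hN).1 ξ hξ ξ' hξ' (hconst N hN ξ hξ ξ' hξ' hrel)
  -- the multiples of `α` at consecutive scales coincide, as `α` is badly approximable
  have hbconst : ∀ N (hN : N₀ ≤ N), b N hN = b N₀ le_rfl := by
    intro N hN
    induction N, hN using Nat.le_induction with
    | base => rfl
    | succ N hN ih =>
      rw [← ih]
      by_contra hne
      have hNR : (1 : ℝ) ≤ N := by exact_mod_cast hpos N hN
      have h1 := hα _ (sub_ne_zero.2 hne)
      have h2 := hb1 N hN
      have h3 := hb2 N hN
      have h2' := hb1 (N + 1) (hN.trans N.le_succ)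
      have h3' := hb2 (N + 1) (hN.trans N.le_succ)
      set m := b N hN
      set m' := b (N + 1) (hN.trans N.le_succ)
      have e : (m' - m) • (α : Circ) =
          (ξ - ξ' - m • (α : Circ)) - (ξ - ξ' - m' • (α : Circ)) := by rw [sub_smul]; abel
      rw [e] at h1
      push_cast at h1 h2' h3'
      have h4 : |(m' : ℝ) - m| ≤ 3 * ε * N := (abs_sub _ _).trans (by nlinarith)
      have h5 : N * ‖(ξ - ξ' - m • (α : Circ)) - (ξ - ξ' - m' • (α : Circ))‖ ≤ 2 * ε := by
        have h6 := mul_le_mul_of_nonneg_left (norm_sub_le (ξ - ξ' - m • (α : Circ))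
          (ξ - ξ' - m' • (α : Circ))) (Nat.cast_nonneg N : (0 : ℝ) ≤ N)
        nlinarith [norm_nonneg (ξ - ξ' - m' • (α : Circ))]
      have h7 : c ≤ (3 * ε * N) * ‖(ξ - ξ' - m • (α : Circ)) - (ξ - ξ' - m' • (α : Circ))‖ :=
        h1.trans (by gcongr)
      nlinarith
  refine ⟨b N₀ le_rfl, ?_⟩
  have hlim : Tendsto (fun N : ℕ => ε / N) atTop (𝓝 0) := tendsto_const_div_atTop_nhds_zero_nat ε
  have hle : ‖ξ - ξ' - b N₀ le_rfl • (α : Circ)‖ ≤ 0 := by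
    refine ge_of_tendsto hlim ?_
    filter_upwards [eventually_ge_atTop N₀] with N hN
    have hNR : (0 : ℝ) < N := by exact_mod_cast hpos N hN
    rw [le_div_iff₀ hNR, mul_comm, ← hbconst N hN]
    exact hb2 N hN
  exact sub_eq_zero.1 (norm_le_zero_iff.1 hle)

/-! ### The cohomological equation over the rotation -/

theorem volume_eq_haarAddCircle : (volume : Measure Circ) = AddCircle.haarAddCircle := by
  simp [AddCircle.volume_eq_smul_haarAddCircle]

/-- The eigenvalues of the rotation by `α` are the numbers `exp (2πilα)`: some Fourier coefficient
of an eigenfunction does not vanish. -/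
theorem exists_int_eq_exp_of_add_eq_mul {α : ℝ} {φ : Circ → ℂ} (hφ : Measurable φ)
    (hφ1 : ∀ x, ‖φ x‖ = 1) {lam : ℂ} (h : ∀ᵐ x, φ (x + (α : Circ)) = lam * φ x) :
    ∃ l : ℤ, lam = Complex.exp (2 * Real.pi * Complex.I * (l * α)) := by
  have hm : MemLp φ 2 (AddCircle.haarAddCircle (T := 1)) :=
    MemLp.of_bound hφ.aestronglyMeasurable 1 (ae_of_all _ fun x => (hφ1 x).le)
  obtain ⟨n, hn⟩ : ∃ n, fourierCoeff φ n ≠ 0 := by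
    by_contra hall
    push Not at hall
    have h1 := tsum_sq_fourierCoeff (hm.toLp φ)
    rw [fourierCoeff_congr_ae hm.coeFn_toLp] at h1
    have h2 : ∫ t : Circ, ‖hm.toLp φ t‖ ^ 2 ∂AddCircle.haarAddCircle =
        ∫ t : Circ, (1 : ℝ) ∂AddCircle.haarAddCircle := by
      refine integral_congr_ae ?_
      filter_upwards [hm.coeFn_toLp] with x hx
      rw [hx, hφ1, one_pow]
    rw [h2] at h1
    simp [hall] at h1
  refine ⟨n, ?_⟩
  have h1 : fourierCoeff φ n = fourier (-n) (α : Circ) * lam * fourierCoeff φ n := by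
    calc fourierCoeff φ n
        = ∫ x : Circ, fourier (-n) (x + (α : Circ)) • φ (x + (α : Circ))
            ∂AddCircle.haarAddCircle := by
          rw [integral_add_right_eq_self (μ := AddCircle.haarAddCircle)
            (fun x : Circ => fourier (-n) x • φ x)]
          rfl
      _ = ∫ x : Circ, (fourier (-n) (α : Circ) * lam) * (fourier (-n) x • φ x)
            ∂AddCircle.haarAddCircle := by
          rw [volume_eq_haarAddCircle] at h
          refine integral_congr_ae ?_
          filter_upwards [h] with x hx
          have e : (fourier (-n) (x + (α : Circ)) : ℂ) =
              fourier (-n) x * fourier (-n) (α : Circ) := by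
            simp [fourier_apply, AddCircle.toCircle_add, smul_add]
          rw [hx, e, smul_eq_mul, smul_eq_mul]; ring
      _ = _ := by rw [integral_const_mul]; rfl
  have h2 : fourier (-n) (α : Circ) * lam = 1 := by
    have := mul_right_cancel₀ hn ((one_mul _).trans h1)
    exact this.symm
  have h3 : (fourier (-n) (α : Circ) : ℂ) * fourier n (α : Circ) = 1 := by
    rw [← fourier_add]; simp
  have h4 : lam = fourier n (α : Circ) := by
    calc lam = (fourier (-n) (α : Circ) * fourier n (α : Circ)) * lam := by rw [h3, one_mul]
      _ = (fourier (-n) (α : Circ) * lam) * fourier n (α : Circ) := by ring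
      _ = _ := by rw [h2, one_mul]
  rw [h4, fourier_coe_apply]
  congr 1
  push_cast
  ring

/-- A function and its translate by a multiple of `α` differ by a coboundary. -/
theorem exists_transfer (α : ℝ) {w : Circ → ℝ} (hw : Measurable w) (b : ℤ) :
    ∃ u : Circ → ℝ, Measurable u ∧
      ∀ x, w (x - b • (α : Circ)) = w x + (u (x + (α : Circ)) - u x) := by
  induction b using Int.induction_on with
  | zero => exact ⟨0, measurable_zero, fun x => by simp⟩
  | succ n ih =>
    obtain ⟨u, hu, h⟩ := ih
    refine ⟨fun x => u x - w (x - (n + 1 : ℤ) • (α : Circ)),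
      hu.sub (hw.comp (measurable_sub_const _)), fun x => ?_⟩
    have e : x + (α : Circ) - (n + 1 : ℤ) • (α : Circ) = x - (n : ℤ) • (α : Circ) := by
      rw [add_smul, one_smul]; abel
    simp only [e, h x]
    ring
  | pred n ih =>
    obtain ⟨u, hu, h⟩ := ih
    refine ⟨fun x => u x + w (x - (-n : ℤ) • (α : Circ)),
      hu.add (hw.comp (measurable_sub_const _)), fun x => ?_⟩
    have e : x + (α : Circ) - (-n : ℤ) • (α : Circ) = x - (-n - 1 : ℤ) • (α : Circ) := by
      rw [sub_smul, one_smul]; abel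
    simp only [e, h x]
    ring

theorem exists_int_rep_sub (x y : Circ) : ∃ m : ℤ, rep (x - y) = rep x - rep y + m := by
  have h : ((rep (x - y) - (rep x - rep y) : ℝ) : Circ) = 0 := by
    rw [AddCircle.coe_sub, AddCircle.coe_sub, coe_rep, coe_rep, coe_rep, sub_self]
  obtain ⟨m, hm⟩ := (AddCircle.coe_eq_zero_iff 1).1 h
  refine ⟨m, ?_⟩
  simp only [zsmul_eq_mul, mul_one] at hm
  linarith

/-- A choice of a point of `Ξ` in the class of `ξ`, which depends on the class only. -/
def classRep (Ξ : Finset Circ) (s : Setoid Circ) (ξ : Circ) : Circ :=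
  Classical.epsilon fun ζ => ζ ∈ Ξ ∧ s ζ ξ

theorem classRep_spec {Ξ : Finset Circ} (s : Setoid Circ) {ξ : Circ} (h : ξ ∈ Ξ) :
    classRep Ξ s ξ ∈ Ξ ∧ s (classRep Ξ s ξ) ξ :=
  Classical.epsilon_spec (p := fun ζ => ζ ∈ Ξ ∧ s ζ ξ) ⟨ξ, h, s.refl' ξ⟩

theorem classRep_eq_iff {Ξ : Finset Circ} (s : Setoid Circ) {ξ ξ' : Circ} (h : ξ ∈ Ξ)
    (h' : ξ' ∈ Ξ) : classRep Ξ s ξ = classRep Ξ s ξ' ↔ s ξ ξ' := by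
  constructor
  · intro e
    have h1 := (classRep_spec s h).2
    rw [e] at h1
    exact s.trans' (s.symm' h1) (classRep_spec s h').2
  · intro hs
    unfold classRep
    congr 1
    funext ζ
    rw [eq_iff_iff]
    exact and_congr_right fun _ => ⟨fun h => s.trans' h hs, fun h => s.trans' h (s.symm' hs)⟩

open Classical in
/-- If the sum of the weights of each class is an integer, then so is each combination of the
weights whose integer coefficients depend on the class only. -/
theorem exists_int_eq_sum_classRep {r : ℝ} {Ξ : Finset Circ} {d : Circ → ℝ} {s : Setoid Circ}
    (hs : ∀ ξ₀ ∈ Ξ, ∃ k : ℤ, r * ∑ ξ ∈ Ξ with s ξ ξ₀, d ξ = k) (m : Circ → ℤ) :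
    ∃ k : ℤ, ∑ ξ ∈ Ξ, r * d ξ * m (classRep Ξ s ξ) = k := by
  rw [← Finset.sum_fiberwise_of_maps_to (t := Ξ.image (classRep Ξ s))
    (fun i hi => Finset.mem_image_of_mem _ hi)]
  have : ∀ y ∈ Ξ.image (classRep Ξ s), ∃ k : ℤ,
      ∑ ξ ∈ Ξ with classRep Ξ s ξ = y, r * d ξ * m (classRep Ξ s ξ) = k := by
    intro y hy
    obtain ⟨ξ₀, hξ₀, rfl⟩ := Finset.mem_image.1 hy
    obtain ⟨k, hk⟩ := hs ξ₀ hξ₀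
    refine ⟨k * m (classRep Ξ s ξ₀), ?_⟩
    push_cast
    rw [← hk, Finset.mul_sum, Finset.sum_mul]
    refine Finset.sum_congr ?_ ?_
    · exact Finset.filter_congr fun ξ hξ => classRep_eq_iff s hξ hξ₀
    · intro ξ hξ
      rw [Finset.mem_filter] at hξ
      rw [(classRep_eq_iff s hξ.1 hξ₀).2 hξ.2]
  choose! k hk using this
  exact ⟨∑ y ∈ Ξ.image (classRep Ξ s), k y, by rw [Finset.sum_congr rfl hk]; push_cast; rfl⟩

open Classical in
/-- When the clusters consist of points of one orbit and have integral sums, the circle-valued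
cocycle `exp (2πirf)` is cohomologous to a constant, which must then be an eigenvalue of the
rotation. This computes the constant term of `f`. -/
theorem exists_const_eq_of_integral_classes {α r C : ℝ} {Ξ : Finset Circ}
    {f d : Circ → ℝ} (hsum : ∑ ξ ∈ Ξ, d ξ = 0)
    (hf : ∀ x ∉ Ξ, f x = C + ∑ ξ ∈ Ξ, d ξ * rep (x - ξ)) {ψ : Circ → ℂ}
    (hψ : Measurable ψ) (hψ1 : ∀ x, ‖ψ x‖ = 1)
    (hcob : ∀ᵐ x, ψ (x + (α : Circ)) = Complex.exp (2 * Real.pi * Complex.I * r * f x) * ψ x)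
    {s : Setoid Circ} (hs1 : ∀ ξ ∈ Ξ, ∀ ξ' ∈ Ξ, s ξ ξ' → ∃ b : ℤ, ξ - ξ' = b • (α : Circ))
    (hs2 : ∀ ξ₀ ∈ Ξ, ∃ k : ℤ, r * ∑ ξ ∈ Ξ with s ξ ξ₀, d ξ = k) :
    ∃ (k l : ℤ) (a b : Circ → ℤ),
      r * C = k + l * α + ∑ ξ ∈ Ξ, r * d ξ * (rep ξ + a ξ + b ξ * α) := by
  have hb : ∀ ξ, ∃ b : ℤ, ξ ∈ Ξ → ξ - classRep Ξ s ξ = b • (α : Circ) := by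
    intro ξ
    by_cases hξ : ξ ∈ Ξ
    · obtain ⟨b, hb⟩ := hs1 ξ hξ _ (classRep_spec s hξ).1 (s.symm' (classRep_spec s hξ).2)
      exact ⟨b, fun _ => hb⟩
    · exact ⟨0, fun h => absurd h hξ⟩
  choose b hb using hb
  have hu : ∀ ξ : Circ, ∃ u : Circ → ℝ, Measurable u ∧ (ξ ∈ Ξ →
      ∀ x, rep (x - ξ) = rep (x - classRep Ξ s ξ) + (u (x + (α : Circ)) - u x)) := by
    intro ξ
    obtain ⟨u, hu, h⟩ := exists_transfer α
      (measurable_rep.comp (measurable_sub_const (classRep Ξ s ξ))) (b ξ)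
    refine ⟨u, hu, fun hξ x => ?_⟩
    have := h x
    simp only [Function.comp_apply] at this
    rw [← this, ← hb ξ hξ]
    congr 1; abel
  choose u hum hu using hu
  choose m hm using exists_int_rep_sub
  set U : Circ → ℝ := fun x => ∑ ξ ∈ Ξ, r * d ξ * u ξ x with hU
  have hUm : Measurable U := Finset.measurable_fun_sum _ fun ξ _ => (hum ξ).const_mul _
  set K : ℝ := ∑ ξ ∈ Ξ, r * d ξ * rep (classRep Ξ s ξ) with hK
  have hrf : ∀ x ∉ Ξ, ∃ k : ℤ, r * f x = (r * C - K) + (U (x + (α : Circ)) - U x) + k := by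
    intro x hx
    obtain ⟨k, hk⟩ := exists_int_eq_sum_classRep hs2 (m x)
    refine ⟨k, ?_⟩
    have h1 : ∀ ξ ∈ Ξ, r * (d ξ * rep (x - ξ)) = r * d ξ * rep x -
        r * d ξ * rep (classRep Ξ s ξ) + r * d ξ * m x (classRep Ξ s ξ) +
        (r * d ξ * u ξ (x + (α : Circ)) - r * d ξ * u ξ x) := by
      intro ξ hξ
      rw [hu ξ hξ x, hm x (classRep Ξ s ξ)]; ring
    rw [hf x hx, mul_add, Finset.mul_sum, Finset.sum_congr rfl h1, Finset.sum_add_distrib,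
      Finset.sum_add_distrib, Finset.sum_sub_distrib, Finset.sum_sub_distrib, hk, ← hK,
      ← Finset.sum_mul, ← Finset.mul_sum, hsum]
    simp only [hU]
    ring
  set φ : Circ → ℂ := fun x => Complex.exp ((-(2 * Real.pi * U x) : ℝ) * Complex.I) * ψ x with hφ
  have hφm : Measurable φ := (Complex.measurable_exp.comp
    ((Complex.measurable_ofReal.comp (hUm.const_mul _).neg).mul_const _)).mul hψ
  have hφ1 : ∀ x, ‖φ x‖ = 1 := fun x => by
    rw [hφ, norm_mul, Complex.norm_exp_ofReal_mul_I, hψ1, one_mul]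
  have hφe : ∀ᵐ x, φ (x + (α : Circ)) =
      Complex.exp (2 * Real.pi * Complex.I * ((r * C - K : ℝ))) * φ x := by
    filter_upwards [hcob, ae_notMem_finset Ξ] with x hx hxΞ
    obtain ⟨k, hk⟩ := hrf x hxΞ
    simp only [hφ, hx]
    rw [← mul_assoc, ← mul_assoc, ← Complex.exp_add, ← Complex.exp_add]
    congr 1
    rw [Complex.exp_eq_exp_iff_exists_int]
    refine ⟨k, ?_⟩
    have hk' : (r : ℂ) * f x = (r * C - K) + (U (x + (α : Circ)) - U x) + k := by
      exact_mod_cast congrArg (fun z : ℝ => (z : ℂ)) hk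
    push_cast
    linear_combination (2 * Real.pi * Complex.I) * hk'
  obtain ⟨l, hl⟩ := exists_int_eq_exp_of_add_eq_mul hφm hφ1 hφe
  rw [Complex.exp_eq_exp_iff_exists_int] at hl
  obtain ⟨k, hk⟩ := hl
  have hkr : r * C - K = l * α + k := by
    have : ((r * C - K : ℝ) : ℂ) = ((l * α + k : ℝ) : ℂ) := by
      refine mul_left_cancel₀ Complex.two_pi_I_ne_zero ?_
      push_cast at hk ⊢
      linear_combination hk
    exact_mod_cast this
  -- `rep` of the representative of `ξ` is `rep ξ - b α` up to an integer
  have ha : ∀ ξ, ∃ a : ℤ, ξ ∈ Ξ → rep (classRep Ξ s ξ) = rep ξ + a + (-b ξ : ℤ) * α := by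
    intro ξ
    have : ∃ a : ℤ, ξ ∈ Ξ → (a : ℝ) = rep (classRep Ξ s ξ) - rep ξ + b ξ * α := by
      by_cases hξ : ξ ∈ Ξ
      · have h1 : ((rep (classRep Ξ s ξ) - rep ξ + b ξ * α : ℝ) : Circ) = 0 := by
          rw [AddCircle.coe_add, AddCircle.coe_sub, coe_rep, coe_rep, ← zsmul_eq_mul,
            AddCircle.coe_zsmul, ← hb ξ hξ]
          abel
        obtain ⟨a, ha⟩ := (AddCircle.coe_eq_zero_iff 1).1 h1
        exact ⟨a, fun _ => by simpa using ha⟩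
      · exact ⟨0, fun h => absurd h hξ⟩
    obtain ⟨a, ha⟩ := this
    refine ⟨a, fun hξ => ?_⟩
    rw [ha hξ]; push_cast; ring
  choose a ha using ha
  refine ⟨k, l, a, fun ξ => -b ξ, ?_⟩
  have hK' : K = ∑ ξ ∈ Ξ, r * d ξ * (rep ξ + a ξ + (-b ξ : ℤ) * α) :=
    Finset.sum_congr rfl fun ξ hξ => by rw [ha ξ hξ]
  rw [← hK']
  linarith

/-- Under (P1) and (P2), the cohomological equation for `exp (2πirf)` over the rotation by `α` has
no solution of modulus one unless `r = 0`. -/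
theorem not_exists_transfer_function {α : ℝ} (hα : Irrational α)
    (hbpq : HasBoundedPartialQuotients α) {f : Circ → ℝ} {C : ℝ}
    {Ξ : Finset Circ} (hne : Ξ.Nonempty)
    (hsum : ∑ ξ ∈ Ξ, jump f ξ = 0)
    (hf : ∀ x ∉ Ξ, f x = C + ∑ ξ ∈ Ξ, jump f ξ * rep (x - ξ))
    (hP1 : PropertyP1 α f Ξ) (hP2 : PropertyP2 α f Ξ) {r : ℝ} (hr : r ≠ 0) {ψ : Circ → ℂ}
    (hψ : Measurable ψ) (hψ1 : ∀ x, ‖ψ x‖ = 1)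
    (hcob : ∀ᵐ x, ψ (x + (α : Circ)) = Complex.exp (2 * Real.pi * Complex.I * r * f x) * ψ x) :
    False := by
  classical
  obtain ⟨c, hc, hbad⟩ := exists_le_abs_mul_norm_zsmul hα hbpq
  obtain ⟨s, hs1, hs2⟩ := exists_setoid_sub_mem_zmultiples (d := jump f) hr hc hbad hP1
    fun ε hε => eventually_exists_isIntegralClustering hε fun 𝒰 h𝒰 ξ₀ =>
      exists_int_eq_mul_sum_near hc hbad hsum hf hψ hψ1 hcob 𝒰 h𝒰 ξ₀
  obtain ⟨k, l, a, b, hkl⟩ := exists_const_eq_of_integral_classes hsum hf hψ hψ1 hcob hs1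
    fun ξ₀ h => (hs2 ξ₀ h).imp fun _ h => h.2
  obtain ⟨ξ₀, hξ₀⟩ := hne
  obtain ⟨k₀, hk₀, hr0⟩ := hs2 ξ₀ hξ₀
  have hk₀R : (k₀ : ℝ) ≠ 0 := by exact_mod_cast hk₀
  refine hP2 ⟨fun ξ => a ξ + if s ξ ξ₀ then (k : ℚ) / k₀ else 0,
    fun ξ => b ξ + if s ξ ξ₀ then (l : ℚ) / k₀ else 0, ?_⟩
  rw [integral_eq_of_eq_add_sum_rep hsum hf]
  refine mul_left_cancel₀ hr ?_
  -- the cluster of `ξ₀` expresses `1 / r` as a rational multiple of a sum of jumps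
  have h1 : ∀ ξ ∈ Ξ, r * ((rep ξ + ((a ξ + if s ξ ξ₀ then (k : ℚ) / k₀ else 0 : ℚ) : ℝ) +
      ((b ξ + if s ξ ξ₀ then (l : ℚ) / k₀ else 0 : ℚ) : ℝ) * α) * jump f ξ) =
      r * jump f ξ * (rep ξ + a ξ + b ξ * α) +
        (k + l * α) / k₀ * r * (if s ξ ξ₀ then jump f ξ else 0) := by
    intro ξ _
    split_ifs
    · push_cast
      field_simp
      ring
    · push_cast
      ring
  rw [hkl, Finset.mul_sum, Finset.sum_congr rfl h1, Finset.sum_add_distrib, ← Finset.mul_sum,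
    ← Finset.sum_filter, mul_assoc ((k + l * α) / (k₀ : ℝ)), hr0]
  field_simp
  ring

/-! ### Eigenfunctions of the special flow -/

theorem rotSum_zero (α : ℝ) (f : Circ → ℝ) (x : Circ) : rotSum α f 0 x = 0 := by
  simp [rotSum]

theorem rotSum_one (α : ℝ) (f : Circ → ℝ) (x : Circ) : rotSum α f 1 x = f x := by
  have := rotSum_add_one α f 0 x
  rw [rotSum_zero] at this
  simpa using this

theorem rotSum_two (α : ℝ) (f : Circ → ℝ) (x : Circ) :
    rotSum α f (1 + 1) x = f x + f (x + (α : Circ)) := by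
  rw [rotSum_add_one, rotSum_one, one_smul]

theorem specialFlow_eq {α : ℝ} {f : Circ → ℝ} (hpos : ∀ x, 0 < f x) {t : ℝ} {p : Space f} {n : ℤ}
    (h1 : rotSum α f n p.1.1 ≤ p.1.2 + t) (h2 : p.1.2 + t < rotSum α f (n + 1) p.1.1) :
    (specialFlow α f t p).1 = (p.1.1 + n • (α : Circ), p.1.2 + t - rotSum α f n p.1.1) := by
  have hmono : StrictMono fun n : ℤ => rotSum α f n p.1.1 := by
    refine strictMono_int_of_lt_succ fun m => ?_
    rw [rotSum_add_one]
    linarith [hpos (p.1.1 + m • (α : Circ))]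
  have hex : ∃ n : ℤ, rotSum α f n p.1.1 ≤ p.1.2 + t ∧ p.1.2 + t < rotSum α f (n + 1) p.1.1 :=
    ⟨n, h1, h2⟩
  have hn : hex.choose = n := by
    have h3 := hex.choose_spec
    have h4 : n < hex.choose + 1 := hmono.lt_iff_lt.1 (h1.trans_lt h3.2)
    have h5 : hex.choose < n + 1 := hmono.lt_iff_lt.1 (h3.1.trans_lt h2)
    omega
  unfold specialFlow
  rw [dif_pos hex]
  simp only [hn]

/-- The eigenfunction `g`, multiplied by `exp (-2πirs)` and extended by zero to `𝕋 × ℝ`. An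
eigenfunction equation for `g` makes it independent of the second coordinate. -/
def unrolled (f : Circ → ℝ) (r : ℝ) (g : Space f → ℂ) (p : Circ × ℝ) : ℂ :=
  Complex.exp (-(2 * Real.pi * Complex.I * r * p.2)) * Function.extend Subtype.val g 0 p

theorem unrolled_coe {f : Circ → ℝ} {r : ℝ} {g : Space f → ℂ} (p : Space f) :
    unrolled f r g p.1 = Complex.exp (-(2 * Real.pi * Complex.I * r * p.1.2)) * g p := by
  rw [unrolled, Subtype.val_injective.extend_apply]

theorem measurableSet_space {f : Circ → ℝ} (hf : Measurable f) :
    MeasurableSet {p : Circ × ℝ | 0 ≤ p.2 ∧ p.2 < f p.1} :=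
  (measurableSet_le measurable_const measurable_snd).inter
    (measurableSet_lt measurable_snd (hf.comp measurable_fst))

theorem measurable_unrolled {f : Circ → ℝ} (hf : Measurable f) (r : ℝ) {g : Space f → ℂ}
    (hg : Measurable g) : Measurable (unrolled f r g) := by
  refine Measurable.mul ?_ ?_
  · exact Complex.measurable_exp.comp
      ((Complex.measurable_ofReal.comp measurable_snd).const_mul _).neg
  · exact (MeasurableEmbedding.subtype_coe (measurableSet_space hf)).measurable_extend hg
      measurable_zero

theorem ae_spaceMeasure_iff {f : Circ → ℝ} (hf : Measurable f) {P : Circ × ℝ → Prop} :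
    (∀ᵐ p ∂spaceMeasure f, P p.1) ↔
      ∀ᵐ p : Circ × ℝ, 0 ≤ p.2 ∧ p.2 < f p.1 → P p := by
  have h := measurableSet_space hf
  exact (ae_restrict_iff_subtype h).symm.trans (ae_restrict_iff' h)

/-- In terms of `unrolled`, the eigenfunction equation inside the fibres and at the first passage
through the roof. -/
theorem ae_unrolled_eq {α : ℝ} {f : Circ → ℝ} (hf : Measurable f) (hpos : ∀ x, 0 < f x) {r : ℝ}
    {g : Space f → ℂ} {t : ℝ} (h : ∀ᵐ p ∂spaceMeasure f, g (specialFlow α f t p) =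
      Complex.exp (2 * Real.pi * Complex.I * r * t) * g p) :
    ∀ᵐ p : Circ × ℝ, 0 ≤ p.2 → p.2 < f p.1 →
      (0 ≤ p.2 + t → p.2 + t < f p.1 → unrolled f r g (p.1, p.2 + t) = unrolled f r g p) ∧
      (f p.1 ≤ p.2 + t → p.2 + t < f p.1 + f (p.1 + (α : Circ)) →
        unrolled f r g (p.1 + (α : Circ), p.2 + t - f p.1) =
          Complex.exp (2 * Real.pi * Complex.I * r * f p.1) * unrolled f r g p) := by
  have h' : ∀ᵐ p ∂spaceMeasure f,
      (0 ≤ p.1.2 + t → p.1.2 + t < f p.1.1 →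
        unrolled f r g (p.1.1, p.1.2 + t) = unrolled f r g p.1) ∧
      (f p.1.1 ≤ p.1.2 + t → p.1.2 + t < f p.1.1 + f (p.1.1 + (α : Circ)) →
        unrolled f r g (p.1.1 + (α : Circ), p.1.2 + t - f p.1.1) =
          Complex.exp (2 * Real.pi * Complex.I * r * f p.1.1) * unrolled f r g p.1) := by
    filter_upwards [h] with p hp
    constructor
    · intro h1 h2
      have e := specialFlow_eq (α := α) hpos (p := p) (t := t) (n := 0) (by rwa [rotSum_zero])
        (by rwa [zero_add, rotSum_one])
      rw [rotSum_zero, zero_smul, add_zero, sub_zero] at e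
      rw [← e, unrolled_coe, unrolled_coe, hp, e, ← mul_assoc, ← Complex.exp_add]
      congr 2
      push_cast; ring
    · intro h1 h2
      have e := specialFlow_eq (α := α) hpos (p := p) (t := t) (n := 1) (by rwa [rotSum_one])
        (by rwa [rotSum_two])
      rw [rotSum_one, one_smul] at e
      rw [← e, unrolled_coe, unrolled_coe, hp, e, ← mul_assoc, ← mul_assoc, ← Complex.exp_add,
        ← Complex.exp_add]
      congr 2
      push_cast; ring
  have := (ae_spaceMeasure_iff hf (P := fun p =>
      (0 ≤ p.2 + t → p.2 + t < f p.1 →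
        unrolled f r g (p.1, p.2 + t) = unrolled f r g p) ∧
      (f p.1 ≤ p.2 + t → p.2 + t < f p.1 + f (p.1 + (α : Circ)) →
        unrolled f r g (p.1 + (α : Circ), p.2 + t - f p.1) =
          Complex.exp (2 * Real.pi * Complex.I * r * f p.1) * unrolled f r g p))).1 h'
  filter_upwards [this] with p hp h1 h2 using hp ⟨h1, h2⟩

/-- An eigenfunction of the special flow comes from a solution `ψ` of the cohomological equation
for `exp (2πirf)` over the rotation. By Fubini, almost every level `s` represents almost every
fibre, so `ψ` can be taken to be the restriction to one low level. -/
theorem exists_transfer_function_of_eigenfunction {α : ℝ} {f : Circ → ℝ} (hf : Measurable f)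
    {a : ℝ} (ha : 0 < a) (hfa : ∀ x, a ≤ f x) {r : ℝ} {g : Space f → ℂ} (hg : Measurable g)
    (h : ∀ t : ℝ, ∀ᵐ p ∂spaceMeasure f, g (specialFlow α f t p) =
      Complex.exp (2 * Real.pi * Complex.I * r * t) * g p) :
    ∃ ψ : Circ → ℂ, Measurable ψ ∧
      (∀ᵐ x, ψ (x + (α : Circ)) = Complex.exp (2 * Real.pi * Complex.I * r * f x) * ψ x) ∧
      ∀ᵐ p ∂spaceMeasure f, g p = Complex.exp (2 * Real.pi * Complex.I * r * p.1.2) * ψ p.1.1 := by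
  have hpos : ∀ x, 0 < f x := fun x => ha.trans_le (hfa x)
  set H := unrolled f r g with hHdef
  have hH : Measurable H := measurable_unrolled hf r hg
  -- almost all pairs of points in a common fibre have the same value of `H`
  have h1 : ∀ᵐ p : Circ × ℝ, ∀ᵐ s' : ℝ, 0 ≤ p.2 → p.2 < f p.1 → 0 ≤ s' → s' < f p.1 →
      H (p.1, s') = H p := by
    have h2 : ∀ᵐ t : ℝ, ∀ᵐ p : Circ × ℝ, 0 ≤ p.2 → p.2 < f p.1 → 0 ≤ p.2 + t → p.2 + t < f p.1 →
        H (p.1, p.2 + t) = H p :=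
      ae_of_all _ fun t => (ae_unrolled_eq hf hpos (h t)).mono fun p hp h1 h2 => (hp h1 h2).1
    rw [Measure.ae_ae_comm] at h2
    · filter_upwards [h2] with p hp
      have h3 := (measurePreserving_sub_right (volume : Measure ℝ) p.2).quasiMeasurePreserving.ae hp
      filter_upwards [h3] with s' hs' h4 h5 h6 h7
      have := hs' h4 h5 (by rwa [add_sub_cancel]) (by rwa [add_sub_cancel])
      rwa [add_sub_cancel] at this
    · have m1 : Measurable fun q : ℝ × Circ × ℝ => q.2.2 := measurable_snd.comp measurable_snd
      have m2 : Measurable fun q : ℝ × Circ × ℝ => f q.2.1 :=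
        hf.comp (measurable_fst.comp measurable_snd)
      have m3 : Measurable fun q : ℝ × Circ × ℝ => q.2.2 + q.1 := m1.add measurable_fst
      have m4 : Measurable fun q : ℝ × Circ × ℝ => H (q.2.1, q.2.2 + q.1) :=
        hH.comp ((measurable_fst.comp measurable_snd).prodMk m3)
      have m5 : Measurable fun q : ℝ × Circ × ℝ => H q.2 := hH.comp measurable_snd
      exact (measurableSet_le measurable_const m1).imp <| (measurableSet_lt m1 m2).imp <|
        (measurableSet_le measurable_const m3).imp <| (measurableSet_lt m3 m2).imp <|
        measurableSet_eq_fun m4 m5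
  have h2 : ∀ᵐ s : ℝ, ∀ᵐ x : Circ, ∀ᵐ s' : ℝ, 0 ≤ s → s < f x → 0 ≤ s' → s' < f x →
      H (x, s') = H (x, s) := by
    have := (Measure.measurePreserving_swap (μ := (volume : Measure ℝ))
      (ν := (volume : Measure Circ))).quasiMeasurePreserving.ae h1
    exact Measure.ae_ae_of_ae_prod this
  obtain ⟨s₀, hs₀, h3⟩ := Measure.exists_mem_of_measure_ne_zero_of_ae
    (s := Set.Ioo 0 a) (μ := (volume : Measure ℝ)) (by simp [ha]) (ae_restrict_of_ae h2)
  set ψ : Circ → ℂ := fun x => H (x, s₀) with hψdef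
  have hψ : Measurable ψ := hH.comp measurable_prodMk_right
  have h4 : ∀ᵐ x : Circ, ∀ᵐ s : ℝ, 0 ≤ s → s < f x → H (x, s) = ψ x := by
    filter_upwards [h3] with x hx
    filter_upwards [hx] with s hs using hs hs₀.1.le (hs₀.2.trans_le (hfa x))
  refine ⟨ψ, hψ, ?_, ?_⟩
  · -- the passage through the roof at time `a / 2`, on the slice `f x - a / 2 ≤ s < f x`
    have h5 := Measure.ae_ae_of_ae_prod (ae_unrolled_eq hf hpos (h (a / 2)))
    filter_upwards [h4, ae_add_right h4 (α : Circ), h5] with x hx hxα hx5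
    have h6 := (measurePreserving_add_right (volume : Measure ℝ)
      (a / 2 - f x)).quasiMeasurePreserving.ae hxα
    obtain ⟨s, hs, h7, h8, h9⟩ := Measure.exists_mem_of_measure_ne_zero_of_ae
      (s := Set.Ioo (f x - a / 2) (f x)) (μ := (volume : Measure ℝ)) (by simp [ha])
      (ae_restrict_of_ae (hx.and (h6.and hx5)))
    have h10 := hfa x
    have h11 := hfa (x + (α : Circ))
    have hs0 : 0 ≤ s := by linarith [hs.1]
    have h12 := (h9 hs0 hs.2).2 (by linarith [hs.1]) (by linarith [hs.2])
    rw [← h7 hs0 hs.2, ← h8 (by linarith [hs.1]) (by linarith [hs.2]), ← h12]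
    congr 2
    ring
  · have h5 : ∀ᵐ p : Circ × ℝ, 0 ≤ p.2 → p.2 < f p.1 → H p = ψ p.1 := by
      refine (Measure.ae_prod_iff_ae_ae ?_).2 h4
      exact (measurableSet_le measurable_const measurable_snd).imp <|
        (measurableSet_lt measurable_snd (hf.comp measurable_fst)).imp <|
        measurableSet_eq_fun hH (hψ.comp measurable_fst)
    have h6 : ∀ᵐ p ∂spaceMeasure f, H p.1 = ψ p.1.1 :=
      (ae_spaceMeasure_iff hf (P := fun p => H p = ψ p.1)).2 (h5.mono fun p hp h => hp h.1 h.2)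
    filter_upwards [h6] with p hp
    rw [← hp, hHdef, unrolled_coe, ← mul_assoc, ← Complex.exp_add, add_neg_cancel, Complex.exp_zero,
      one_mul]

theorem ergodic_add_coe {α : ℝ} (hα : Irrational α) :
    Ergodic (fun x : Circ => x + (α : Circ)) volume := by
  rw [AddCircle.ergodic_add_right, addOrderOf_eq_zero_iff,
    AddCircle.not_isOfFinAddOrder_iff_forall_rat_ne_div]
  intro q hq
  exact hα ⟨q, by rw [hq, div_one]⟩

end

end SpecialFlow

theorem mainTheorem5 (α : ℝ) (hα : Irrational α)
    (hbpq : SpecialFlow.HasBoundedPartialQuotients α)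
    (f : UnitAddCircle → ℝ) (hpos : ∀ x, 0 < f x)
    (hpc : SpecialFlow.IsPiecewiseConstant f)
    (Ξ : Finset UnitAddCircle) (hΞ : ∀ x, x ∈ Ξ ↔ ¬ ContinuousAt f x)
    (hne : Ξ.Nonempty)
    (hsum : ∑ ξ ∈ Ξ, SpecialFlow.jump f ξ = 0)
    (hP1 : SpecialFlow.PropertyP1 α f Ξ)
    (hP2 : SpecialFlow.PropertyP2 α f Ξ) :
    SpecialFlow.IsWeaklyMixing (SpecialFlow.specialFlow α f) (SpecialFlow.spaceMeasure f) := by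
  intro r g hg hgt
  obtain ⟨C, hC⟩ := SpecialFlow.exists_eq_add_sum_rep hpc hΞ hsum
  have hf : Measurable f := SpecialFlow.measurable_of_eq_add_sum_rep hC
  obtain ⟨a, ha, hfa⟩ := hpc.exists_pos_le hpos
  obtain ⟨ψ, hψ, hcob, hgψ⟩ :=
    SpecialFlow.exists_transfer_function_of_eigenfunction hf ha hfa hg hgt
  have herg := SpecialFlow.ergodic_add_coe hα
  -- almost every point of the space lies over a generic point of the circle
  have hlift : ∀ P : UnitAddCircle → Prop, (∀ᵐ x, P x) →
      ∀ᵐ p ∂SpecialFlow.spaceMeasure f, P p.1.1 := by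
    intro P hP
    refine (SpecialFlow.ae_spaceMeasure_iff hf (P := fun p => P p.1)).2 ?_
    exact (Measure.quasiMeasurePreserving_fst.ae hP).mono fun p hp _ => hp
  rcases eq_or_ne r 0 with rfl | hr
  · obtain ⟨c, hc⟩ := herg.ae_eq_const_of_ae_eq_comp_ae hψ.aestronglyMeasurable
      (hcob.mono fun x hx => by simpa using hx)
    refine ⟨c, ?_⟩
    filter_upwards [hgψ, hlift _ hc] with p hp hpc
    rw [hp, hpc]
    simp
  · obtain ⟨c, hc⟩ := herg.ae_eq_const_of_ae_eq_comp_ae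
      hψ.norm.aestronglyMeasurable (hcob.mono fun x hx => by
        simp only [Function.comp_apply]
        rw [hx, norm_mul]
        have e : (2 * Real.pi * Complex.I * r * f x : ℂ) =
          ((2 * Real.pi * r * f x : ℝ) : ℂ) * Complex.I := by push_cast; ring
        rw [e, Complex.norm_exp_ofReal_mul_I, one_mul])
    rcases eq_or_ne c 0 with rfl | hc0
    · refine ⟨0, ?_⟩
      filter_upwards [hgψ, hlift _ hc] with p hp hpc
      rw [hp, norm_eq_zero.1 hpc, mul_zero]
    · -- a nonzero eigenfunction with `r ≠ 0` is normalised to have modulus one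
      classical
      exfalso
      have hcx : ∀ᵐ x : UnitAddCircle, ‖ψ x‖ = c := hc
      have hc1 : 0 < c := by
        obtain ⟨x, hx⟩ := hcx.exists
        exact lt_of_le_of_ne (hx ▸ norm_nonneg _) (Ne.symm hc0)
      refine SpecialFlow.not_exists_transfer_function hα hbpq hne hsum hC hP1 hP2 hr
        (ψ := fun x => if ‖ψ x‖ = c then ψ x / c else 1) ?_ ?_ ?_
      · exact Measurable.ite (measurableSet_eq_fun hψ.norm measurable_const)
          (hψ.div_const _) measurable_const
      · intro x
        split_ifs with h
        · rw [norm_div, h, Complex.norm_real, Real.norm_of_nonneg hc1.le, div_self hc0]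
        · exact norm_one
      · filter_upwards [hcob, hcx, SpecialFlow.ae_add_right hcx (α : UnitAddCircle)] with x h1 h2 h3
        rw [if_pos h2, if_pos h3, h1, mul_div_assoc]
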